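/- A 2-category means a bicategory; $\circ$ is composition of transformations (right factor first) and $*$ is whiskering. A transformation $\sigma\colon P\Rightarrow Q$ between weak 2-functors has components $\sigma_a$ and invertible cells $\sigma(f)\colon \sigma_b\circ Pf\Rightarrow Qf\circ\sigma_a$ for $f\colon a\to b$. For a 2-category $\mathcal A$, let $\operatorname{Dim}\mathcal A$ be the braided monoidal category whose objects are the transformations $\mathrm{id}_{\mathcal A}\Rightarrow\mathrm{id}_{\mathcal A}$, whose morphisms are modifications, with tensor product $T\otimes S=T\circ S$ and braiding $T\circ S\Rrightarrow S\circ T$ having component $T(S_a)$ at $a$. A coherent adjoint equivalence between 2-categories $\mathcal A$ and $\mathcal B$ consists of weak 2-functors $F\colon\mathcal A\to\mathcal B$, $G\colon\mathcal B\to\mathcal A$; transformations $\eta\colon\mathrm{id}_{\mathcal A}\Rightarrow GF$, $\eta^*\colon GF\Rightarrow\mathrm{id}_{\mathcal A}$, $\epsilon\colon FG\Rightarrow\mathrm{id}_{\mathcal B}$, $\epsilon^*\colon\mathrm{id}_{\mathcal B}\Rightarrow FG$; invertible modifications (triangulators) $$\Delta_1\colon(\epsilon F)\circ(F\eta)\Rrightarrow\mathrm{id}_F,\quad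 \Delta_2\colon(G\epsilon)\circ(\eta G)\Rrightarrow\mathrm{id}_G,\quad \Delta_1'\colon(F\eta^*)\circ(\epsilon^*F)\Rrightarrow\mathrm{id}_F,\quad \Delta_2'\colon(\eta^*G)\circ(G\epsilon^*)\Rrightarrow\mathrm{id}_G;$$ and invertible modifications $b\colon\mathrm{id}\Rrightarrow\eta^*\circ\eta$, $b'\colon\mathrm{id}\Rrightarrow\epsilon\circ\epsilon^*$ (births), $s\colon\eta\circ\eta^*\Rrightarrow\mathrm{id}_{GF}$, $s'\colon\epsilon^*\circ\epsilon\Rrightarrow\mathrm{id}_{FG}$ (saddles), such that, up to the coherence isomorphisms: (1) Swallowtail rules. The modification $\epsilon\circ FG\epsilon\circ F\eta G\Rrightarrow\epsilon$ induced by $F\Delta_2$ equals the one obtained by the interchange $\epsilon\circ FG\epsilon\cong\epsilon\circ\epsilon FG$ followed by $\Delta_1G$; the modification $G\epsilon F\circ GF\eta\circ\eta\Rrightarrow\eta$ induced by $G\Delta_1$ equals the one obtained by the interchange $GF\eta\circ\eta\cong\eta GF\circ\eta$ followed by $\Delta_2F$; and the two rules obtained from these by replacing $(\mathcal A,\mathcal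 B,F,G,\eta,\epsilon,\Delta_1,\Delta_2)$ by $(\mathcal B,\mathcal A,G,F,\epsilon^*,\eta^*,\Delta_2',\Delta_1')$ hold. (2) Horizontal cusp rules. The modifications $\epsilon F\Rrightarrow\epsilon F\circ F\eta\circ F\eta^*\Rrightarrow F\eta^*$ (by $Fs^{-1}$, then $\Delta_1$) and $\epsilon F\Rrightarrow F\eta^*\circ\epsilon^*F\circ\epsilon F\Rrightarrow F\eta^*$ (by $\Delta_1'^{-1}$, then $s'F$) are equal; the modifications $F\eta\Rrightarrow\epsilon^*F\circ\epsilon F\circ F\eta\Rrightarrow\epsilon^*F$ (by $s'^{-1}F$, then $\Delta_1$) and $F\eta\Rrightarrow F\eta\circ F\eta^*\circ\epsilon^*F\Rrightarrow\epsilon^*F$ (by $\Delta_1'^{-1}$, then $Fs$) are equal; and the two rules obtained from these by replacing $(\mathcal A,\mathcal B,F,G,\eta,\eta^*,\epsilon,\epsilon^*,\Delta_1,\Delta_1',s,s')$ by $(\mathcal B,\mathcal A,G,F,\epsilon^*,\epsilon,\eta^*,\eta,\Delta_2',\Delta_2,s',s)$ hold. Proposition. Given a coherent adjoint equivalence between $\mathcal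 A$ and $\mathcal B$, the functor $$K\colon\operatorname{Dim}\mathcal B\to\operatorname{Dim}\mathcal A,\qquad K(T)=\eta^*\circ(\mathrm{id}_G*T*\mathrm{id}_F)\circ\eta$$ (with the same formula on modifications) is an equivalence of categories and carries the structure of a (strong) braided monoidal functor whose constraint $K(T)\circ K(S)\Rrightarrow K(T\circ S)$ is the modification induced by the saddle $s$. In particular $\operatorname{Dim}\mathcal B\simeq\operatorname{Dim}\mathcal A$ as braided monoidal categories. -/

import Mathlib

open CategoryTheory Bicategory
open scoped Pseudofunctor.StrongTrans

universe w₁ w₂ w₃ w₄ v₁ v₂ v₃ v₄ u₁ u₂ u₃ u₄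

namespace HigherDimension

section Whisker
variable {A : Type u₁} [Bicategory.{w₁, v₁} A] {B : Type u₂} [Bicategory.{w₂, v₂} B]
  {C : Type u₃} [Bicategory.{w₃, v₃} C] {D : Type u₄} [Bicategory.{w₄, v₄} D]

/-- `σ * H`: restriction of a transformation along a weak 2-functor `H`. -/
def preWhisker (H : A ⥤ᵖ B) {P Q : B ⥤ᵖ C} (σ : P ⟶ Q) : H.comp P ⟶ H.comp Q where
  app a := σ.app (H.obj a)
  naturality f := σ.naturality (H.map f)
  naturality_naturality β := σ.naturality_naturality (H.map₂ β)
  naturality_id a := by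
    change (σ.naturality (H.map (𝟙 a))).hom ≫
        σ.app (H.obj a) ◁ (Q.map₂ (H.mapId a).hom ≫ (Q.mapId (H.obj a)).hom) =
      (P.map₂ (H.mapId a).hom ≫ (P.mapId (H.obj a)).hom) ▷ σ.app (H.obj a) ≫
        (λ_ (σ.app (H.obj a))).hom ≫ (ρ_ (σ.app (H.obj a))).inv
    simp only [Bicategory.whiskerLeft_comp, Bicategory.comp_whiskerRight, Category.assoc]
    rw [← σ.naturality_id, ← σ.naturality_naturality_assoc]
  naturality_comp {a b c} f g := by
    change (σ.naturality (H.map (f ≫ g))).hom ≫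
        σ.app (H.obj a) ◁ (Q.map₂ (H.mapComp f g).hom ≫ (Q.mapComp (H.map f) (H.map g)).hom) =
      (P.map₂ (H.mapComp f g).hom ≫ (P.mapComp (H.map f) (H.map g)).hom) ▷ σ.app (H.obj c) ≫
        (α_ _ _ _).hom ≫ P.map (H.map f) ◁ (σ.naturality (H.map g)).hom ≫ (α_ _ _ _).inv ≫
          (σ.naturality (H.map f)).hom ▷ Q.map (H.map g) ≫ (α_ _ _ _).hom
    simp only [Bicategory.whiskerLeft_comp, Bicategory.comp_whiskerRight, Category.assoc]
    rw [← σ.naturality_comp, ← σ.naturality_naturality_assoc]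

theorem map₂_associator_inv (K : A ⥤ᵖ B) {x y z w : A} (p : x ⟶ y) (q : y ⟶ z) (r : z ⟶ w) :
    K.map₂ (α_ p q r).inv =
      (K.mapComp p (q ≫ r)).hom ≫ K.map p ◁ (K.mapComp q r).hom ≫
        (α_ (K.map p) (K.map q) (K.map r)).inv ≫ (K.mapComp p q).inv ▷ K.map r ≫
        (K.mapComp (p ≫ q) r).inv := by
  rw [← cancel_epi (K.map₂ (α_ p q r).hom), ← K.map₂_comp]
  simp

/-- `K * σ`: image of a transformation under a weak 2-functor `K`. -/
def postWhisker {P Q : A ⥤ᵖ B} (σ : P ⟶ Q) (K : B ⥤ᵖ C) : P.comp K ⟶ Q.comp K where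
  app a := K.map (σ.app a)
  naturality {a b} f := (K.mapComp (P.map f) (σ.app b)).symm ≪≫ K.map₂Iso (σ.naturality f) ≪≫
    K.mapComp (σ.app a) (Q.map f)
  naturality_naturality {a b f g} β := by
    change K.map₂ (P.map₂ β) ▷ K.map (σ.app b) ≫ (K.mapComp (P.map g) (σ.app b)).inv ≫
        K.map₂ (σ.naturality g).hom ≫ (K.mapComp (σ.app a) (Q.map g)).hom =
      ((K.mapComp (P.map f) (σ.app b)).inv ≫
        K.map₂ (σ.naturality f).hom ≫ (K.mapComp (σ.app a) (Q.map f)).hom) ≫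
        K.map (σ.app a) ◁ K.map₂ (Q.map₂ β)
    have h := congrArg (fun x => K.map₂ x) (σ.naturality_naturality β)
    simp only [PrelaxFunctor.map₂_comp, Pseudofunctor.map₂_whisker_left,
      Pseudofunctor.map₂_whisker_right, Category.assoc] at h
    rw [← cancel_epi (K.mapComp (P.map f) (σ.app b)).hom,
      ← cancel_mono (K.mapComp (σ.app a) (Q.map g)).inv]
    simpa using h
  naturality_id a := by
    change ((K.mapComp (P.map (𝟙 a)) (σ.app a)).inv ≫
        K.map₂ (σ.naturality (𝟙 a)).hom ≫ (K.mapComp (σ.app a) (Q.map (𝟙 a))).hom) ≫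
        K.map (σ.app a) ◁ (K.map₂ (Q.mapId a).hom ≫ (K.mapId (Q.obj a)).hom) =
      (K.map₂ (P.mapId a).hom ≫ (K.mapId (P.obj a)).hom) ▷ K.map (σ.app a) ≫
        (λ_ (K.map (σ.app a))).hom ≫ (ρ_ (K.map (σ.app a))).inv
    have h := congrArg (fun x => K.map₂ x) (σ.naturality_id a)
    have h2 : K.map₂ (ρ_ (σ.app a)).inv = (ρ_ (K.map (σ.app a))).inv ≫
        K.map (σ.app a) ◁ (K.mapId _).inv ≫ (K.mapComp _ _).inv := by
      rw [← cancel_epi (K.map₂ (ρ_ (σ.app a)).hom), ← K.map₂_comp]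
      simp
    simp only [PrelaxFunctor.map₂_comp, Pseudofunctor.map₂_whisker_left, h2,
      Pseudofunctor.map₂_whisker_right, Pseudofunctor.map₂_left_unitor, Category.assoc] at h
    rw [← cancel_epi (K.mapComp (P.map (𝟙 a)) (σ.app a)).hom,
      ← cancel_mono (K.map (σ.app a) ◁ (K.mapId (Q.obj a)).inv),
      ← cancel_mono (K.mapComp (σ.app a) (𝟙 (Q.obj a))).inv]
    simpa using h
  naturality_comp {a b c} f g := by
    change ((K.mapComp (P.map (f ≫ g)) (σ.app c)).inv ≫
        K.map₂ (σ.naturality (f ≫ g)).hom ≫ (K.mapComp (σ.app a) (Q.map (f ≫ g))).hom) ≫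
        K.map (σ.app a) ◁ (K.map₂ (Q.mapComp f g).hom ≫ (K.mapComp (Q.map f) (Q.map g)).hom) =
      (K.map₂ (P.mapComp f g).hom ≫ (K.mapComp (P.map f) (P.map g)).hom) ▷ K.map (σ.app c) ≫
        (α_ _ _ _).hom ≫ K.map (P.map f) ◁ ((K.mapComp (P.map g) (σ.app c)).inv ≫
        K.map₂ (σ.naturality g).hom ≫ (K.mapComp (σ.app b) (Q.map g)).hom) ≫
        (α_ _ _ _).inv ≫ ((K.mapComp (P.map f) (σ.app b)).inv ≫
        K.map₂ (σ.naturality f).hom ≫ (K.mapComp (σ.app a) (Q.map f)).hom) ▷ K.map (Q.map g) ≫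
        (α_ _ _ _).hom
    have h := congrArg (fun x => K.map₂ x) (σ.naturality_comp f g)
    simp only [PrelaxFunctor.map₂_comp, Pseudofunctor.map₂_whisker_left, map₂_associator_inv,
      Pseudofunctor.map₂_whisker_right, Pseudofunctor.map₂_associator, Category.assoc] at h
    rw [← cancel_epi (K.mapComp (P.map (f ≫ g)) (σ.app c)).hom,
      ← cancel_mono (K.map (σ.app a) ◁ (K.mapComp (Q.map f) (Q.map g)).inv),
      ← cancel_mono (K.mapComp (σ.app a) (Q.map f ≫ Q.map g)).inv]
    simpa using h

theorem pseudofunctor_eq {P Q : A ⥤ᵖ B} (h : P.toPrelaxFunctor = Q.toPrelaxFunctor)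
    (h₁ : HEq P.mapId Q.mapId) (h₂ : HEq (@Pseudofunctor.mapComp _ _ _ _ P)
      (@Pseudofunctor.mapComp _ _ _ _ Q)) : P = Q := by
  cases P; cases Q; cases h; cases h₁; cases h₂; rfl

theorem id_comp (P : A ⥤ᵖ B) : (Pseudofunctor.id A).comp P = P :=
  pseudofunctor_eq rfl
    (heq_of_eq (funext fun a => Iso.ext (by
      change P.map₂ (𝟙 (𝟙 a)) ≫ (P.mapId a).hom = (P.mapId a).hom
      simp)))
    (heq_of_eq (by
      funext a b c f g
      refine Iso.ext ?_
      change P.map₂ (𝟙 (f ≫ g)) ≫ (P.mapComp f g).hom = (P.mapComp f g).hom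
      simp))

theorem comp_id (P : A ⥤ᵖ B) : P.comp (Pseudofunctor.id B) = P :=
  pseudofunctor_eq rfl
    (heq_of_eq (funext fun a => Iso.ext (by
      change (P.mapId a).hom ≫ 𝟙 (𝟙 (P.obj a)) = (P.mapId a).hom
      simp)))
    (heq_of_eq (by
      funext a b c f g
      refine Iso.ext ?_
      change (P.mapComp f g).hom ≫ 𝟙 (P.map f ≫ P.map g) = (P.mapComp f g).hom
      simp))

theorem comp_assoc (P : A ⥤ᵖ B) (Q : B ⥤ᵖ C) (R : C ⥤ᵖ D) :
    (P.comp Q).comp R = P.comp (Q.comp R) :=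
  pseudofunctor_eq rfl
    (heq_of_eq (funext fun a => Iso.ext (by
      change R.map₂ (Q.map₂ (P.mapId a).hom ≫ (Q.mapId _).hom) ≫ (R.mapId _).hom =
        R.map₂ (Q.map₂ (P.mapId a).hom) ≫ R.map₂ (Q.mapId _).hom ≫ (R.mapId _).hom
      simp)))
    (heq_of_eq (by
      funext a b c f g
      refine Iso.ext ?_
      change R.map₂ (Q.map₂ (P.mapComp f g).hom ≫ (Q.mapComp _ _).hom) ≫ (R.mapComp _ _).hom =
        R.map₂ (Q.map₂ (P.mapComp f g).hom) ≫ R.map₂ (Q.mapComp _ _).hom ≫ (R.mapComp _ _).hom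
      simp))

/-- A transformation with the given components and cells, when these agree with those of `σ`
under equalities of the source and target 2-functors. -/
def retype {P Q : A ⥤ᵖ B} (σ : P ⟶ Q) {P' Q' : A ⥤ᵖ B} (hP : P = P') (hQ : Q = Q')
    (app : ∀ a, P'.obj a ⟶ Q'.obj a)
    (cell : ∀ {a b : A} (f : a ⟶ b), P'.map f ≫ app b ≅ app a ≫ Q'.map f)
    (happ : HEq σ.app app) (hcell : HEq (@Pseudofunctor.StrongTrans.naturality _ _ _ _ _ _ σ) (@cell)) :
    P' ⟶ Q' where
  app := app
  naturality f := cell f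
  naturality_naturality β := by
    subst hP hQ; cases happ; cases hcell; exact σ.naturality_naturality β
  naturality_id a := by
    subst hP hQ; cases happ; cases hcell; exact σ.naturality_id a
  naturality_comp f g := by
    subst hP hQ; cases happ; cases hcell; exact σ.naturality_comp f g

/-- `σ * H` for `σ : id ⇒ P`, regarded as a transformation `H ⇒ P H`. -/
def preUnit (H : A ⥤ᵖ B) {P : B ⥤ᵖ B} (σ : Pseudofunctor.id B ⟶ P) : H ⟶ H.comp P :=
  retype (preWhisker H σ) (comp_id H) rfl (fun a => σ.app (H.obj a))
    (fun f => σ.naturality (H.map f)) HEq.rfl HEq.rfl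


/-- `σ * H` for `σ : P ⇒ id`, regarded as a transformation `P H ⇒ H`. -/
def preCounit (H : A ⥤ᵖ B) {P : B ⥤ᵖ B} (σ : P ⟶ Pseudofunctor.id B) : H.comp P ⟶ H :=
  retype (preWhisker H σ) rfl (comp_id H) (fun a => σ.app (H.obj a))
    (fun f => σ.naturality (H.map f)) HEq.rfl HEq.rfl

/-- `σ * H` for `σ : id ⇒ id`, regarded as a transformation `H ⇒ H`. -/
def preEndo (H : A ⥤ᵖ B) (σ : Pseudofunctor.id B ⟶ Pseudofunctor.id B) : H ⟶ H :=
  retype (preWhisker H σ) (comp_id H) (comp_id H) (fun a => σ.app (H.obj a))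
    (fun f => σ.naturality (H.map f)) HEq.rfl HEq.rfl

/-- `K * σ` for `σ : id ⇒ Q P`, regarded as a transformation `K ⇒ K Q P`. -/
def postUnit {P : A ⥤ᵖ B} {Q : B ⥤ᵖ A} (σ : Pseudofunctor.id A ⟶ P.comp Q) (K : A ⥤ᵖ C) :
    K ⟶ P.comp (Q.comp K) :=
  retype (postWhisker σ K) (id_comp K) (comp_assoc P Q K) (fun a => K.map (σ.app a))
    (fun {a b} f => (K.mapComp f (σ.app b)).symm ≪≫ K.map₂Iso (σ.naturality f) ≪≫
      K.mapComp (σ.app a) (Q.map (P.map f))) HEq.rfl HEq.rfl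

/-- `K * σ` for `σ : Q P ⇒ id`, regarded as a transformation `K Q P ⇒ K`. -/
def postCounit {P : A ⥤ᵖ B} {Q : B ⥤ᵖ A} (σ : P.comp Q ⟶ Pseudofunctor.id A) (K : A ⥤ᵖ C) :
    P.comp (Q.comp K) ⟶ K :=
  retype (postWhisker σ K) (comp_assoc P Q K) (id_comp K) (fun a => K.map (σ.app a))
    (fun {a b} f => (K.mapComp (Q.map (P.map f)) (σ.app b)).symm ≪≫
      K.map₂Iso (σ.naturality f) ≪≫ K.mapComp (σ.app a) f) HEq.rfl HEq.rfl

/-- `preEndo H` on modifications. -/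
def preEndoMod (H : A ⥤ᵖ B) {σ τ : Pseudofunctor.id B ⟶ Pseudofunctor.id B} (θ : σ ⟶ τ) :
    preEndo H σ ⟶ preEndo H τ where
  as := {
    app a := θ.as.app (H.obj a)
    naturality f := θ.as.naturality (H.map f) }

/-- `postWhisker` on modifications. -/
def postWhiskerMod {P Q : A ⥤ᵖ B} {σ τ : P ⟶ Q} (θ : σ ⟶ τ) (K : B ⥤ᵖ C) :
    postWhisker σ K ⟶ postWhisker τ K where
  as := {
    app a := K.map₂ (θ.as.app a)
    naturality {a b} f := by
      change K.map (P.map f) ◁ K.map₂ (θ.as.app b) ≫ (K.mapComp (P.map f) (τ.app b)).inv ≫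
          K.map₂ (τ.naturality f).hom ≫ (K.mapComp (τ.app a) (Q.map f)).hom =
        ((K.mapComp (P.map f) (σ.app b)).inv ≫
          K.map₂ (σ.naturality f).hom ≫ (K.mapComp (σ.app a) (Q.map f)).hom) ≫
          K.map₂ (θ.as.app a) ▷ K.map (Q.map f)
      have h := congrArg (fun x => K.map₂ x) (θ.as.naturality f)
      simp only [PrelaxFunctor.map₂_comp, Pseudofunctor.map₂_whisker_left,
        Pseudofunctor.map₂_whisker_right, Category.assoc] at h
      rw [← cancel_epi (K.mapComp (P.map f) (σ.app b)).hom,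
        ← cancel_mono (K.mapComp (τ.app a) (Q.map f)).inv]
      simpa using h }

/-- `(K * τ) ∘ (K * σ) ≅ K * (τ ∘ σ)`, with components the composition constraint of `K`. -/
def postWhiskerComp {P Q R : A ⥤ᵖ B} (σ : P ⟶ Q) (τ : Q ⟶ R) (K : B ⥤ᵖ C) :
    postWhisker σ K ≫ postWhisker τ K ≅ postWhisker (σ ≫ τ) K :=
  Pseudofunctor.StrongTrans.isoMk (fun a => (K.mapComp (σ.app a) (τ.app a)).symm) (by
    intro a b f
    change K.map (P.map f) ◁ (K.mapComp (σ.app b) (τ.app b)).inv ≫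
        (K.mapComp (P.map f) (σ.app b ≫ τ.app b)).inv ≫
        K.map₂ ((α_ _ _ _).inv ≫ (σ.naturality f).hom ▷ τ.app b ≫ (α_ _ _ _).hom ≫
          σ.app a ◁ (τ.naturality f).hom ≫ (α_ _ _ _).inv) ≫
        (K.mapComp (σ.app a ≫ τ.app a) (R.map f)).hom =
      ((α_ _ _ _).inv ≫ ((K.mapComp (P.map f) (σ.app b)).inv ≫ K.map₂ (σ.naturality f).hom ≫
          (K.mapComp (σ.app a) (Q.map f)).hom) ▷ K.map (τ.app b) ≫ (α_ _ _ _).hom ≫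
          K.map (σ.app a) ◁ ((K.mapComp (Q.map f) (τ.app b)).inv ≫ K.map₂ (τ.naturality f).hom ≫
          (K.mapComp (τ.app a) (R.map f)).hom) ≫ (α_ _ _ _).inv) ≫
        (K.mapComp (σ.app a) (τ.app a)).inv ▷ K.map (R.map f)
    simp [map₂_associator_inv])

end Whisker

section Dim
variable (A : Type u₁) [Bicategory.{w₁, v₁} A]

/-- The higher-categorical dimension of a bicategory: transformations of the identity 2-functor,
with modifications as morphisms. -/
def Dim : Type (max u₁ v₁ w₁) := Pseudofunctor.id A ⟶ Pseudofunctor.id A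

instance : Category (Dim A) :=
  inferInstanceAs (Category (Pseudofunctor.id A ⟶ Pseudofunctor.id A))

variable {A}

namespace Dim

/-- The component `T_a`. -/
def app (T : Dim A) (a : A) : a ⟶ a := Pseudofunctor.StrongTrans.app T a

/-- The cell `T(f) : T_b ∘ f ⇒ f ∘ T_a`. -/
def cell (T : Dim A) {a b : A} (f : a ⟶ b) : f ≫ T.app b ≅ T.app a ≫ f :=
  Pseudofunctor.StrongTrans.naturality T f

/-- The component at `a` of a morphism of `Dim A`. -/
def homApp {T S : Dim A} (θ : T ⟶ S) (a : A) : T.app a ⟶ S.app a :=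
  (Pseudofunctor.StrongTrans.Hom.as θ).app a

theorem hom_ext {T S : Dim A} {θ κ : T ⟶ S} (h : ∀ a, homApp θ a = homApp κ a) : θ = κ :=
  Pseudofunctor.StrongTrans.homCategory.ext h

theorem homApp_cell {T S : Dim A} (θ : T ⟶ S) {a b : A} (f : a ⟶ b) :
    f ◁ homApp θ b ≫ (S.cell f).hom = (T.cell f).hom ≫ homApp θ a ▷ f :=
  (Pseudofunctor.StrongTrans.Hom.as θ).naturality f

theorem cell_naturality (T : Dim A) {a b : A} {f g : a ⟶ b} (β : f ⟶ g) :
    β ▷ T.app b ≫ (T.cell g).hom = (T.cell f).hom ≫ T.app a ◁ β :=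
  Pseudofunctor.StrongTrans.naturality_naturality T β

theorem cell_id (T : Dim A) (a : A) :
    (T.cell (𝟙 a)).hom = (λ_ (T.app a)).hom ≫ (ρ_ (T.app a)).inv := by
  have h : (T.cell (𝟙 a)).hom ≫ T.app a ◁ 𝟙 (𝟙 a) =
      𝟙 (𝟙 a) ▷ T.app a ≫ (λ_ (T.app a)).hom ≫ (ρ_ (T.app a)).inv :=
    Pseudofunctor.StrongTrans.naturality_id T a
  simpa using h

theorem cell_comp (T : Dim A) {a b c : A} (f : a ⟶ b) (g : b ⟶ c) :
    (T.cell (f ≫ g)).hom = (α_ _ _ _).hom ≫ f ◁ (T.cell g).hom ≫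
      (α_ _ _ _).inv ≫ (T.cell f).hom ▷ g ≫ (α_ _ _ _).hom := by
  have h : (T.cell (f ≫ g)).hom ≫ T.app a ◁ 𝟙 (f ≫ g) =
      𝟙 (f ≫ g) ▷ T.app c ≫ (α_ _ _ _).hom ≫ f ◁ (T.cell g).hom ≫
      (α_ _ _ _).inv ≫ (T.cell f).hom ▷ g ≫ (α_ _ _ _).hom :=
    Pseudofunctor.StrongTrans.naturality_comp T f g
  simpa using h

/-- The modification `T ∘ S ⇛ S ∘ T` with component `T(S_a)` at `a`. -/
def braidingIso (T S : Dim A) :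
    CategoryStruct.comp (obj := Pseudofunctor A A) S T ≅
      CategoryStruct.comp (obj := Pseudofunctor A A) T S :=
  Pseudofunctor.StrongTrans.isoMk (fun a => T.cell (S.app a)) (by
    intro a b f
    change f ◁ (T.cell (S.app b)).hom ≫ (α_ _ _ _).inv ≫ (T.cell f).hom ▷ S.app b ≫
        (α_ _ _ _).hom ≫ T.app a ◁ (S.cell f).hom ≫ (α_ _ _ _).inv =
      ((α_ _ _ _).inv ≫ (S.cell f).hom ▷ T.app b ≫ (α_ _ _ _).hom ≫ S.app a ◁ (T.cell f).hom ≫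
        (α_ _ _ _).inv) ≫ (T.cell (S.app a)).hom ▷ f
    have h := T.cell_naturality (S.cell f).hom
    rw [cell_comp, cell_comp] at h
    simp only [Category.assoc] at h ⊢
    rw [← cancel_epi (α_ _ _ _).hom, ← cancel_mono (α_ _ _ _).hom]
    simpa using h.symm)

/-- The tensor product is `T ⊗ S = T ∘ S` (first `S`, then `T`); Mathlib's `≫` is written in
diagrammatic order, so that `T ∘ S` is `S ≫ T`. -/
instance : MonoidalCategory (Dim A) where
  tensorObj T S := CategoryStruct.comp (obj := Pseudofunctor A A) S T
  whiskerLeft T _ _ θ := Bicategory.whiskerRight (B := Pseudofunctor A A) θ T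
  whiskerRight θ S := Bicategory.whiskerLeft (B := Pseudofunctor A A) S θ
  tensorUnit := 𝟙 (Pseudofunctor.id A)
  associator T S R := (Bicategory.associator (B := Pseudofunctor A A) R S T).symm
  leftUnitor T := Bicategory.rightUnitor (B := Pseudofunctor A A) T
  rightUnitor T := Bicategory.leftUnitor (B := Pseudofunctor A A) T
  id_tensorHom_id T S := by
    apply hom_ext; intro a
    change S.app a ◁ 𝟙 (T.app a) ≫ 𝟙 (S.app a) ▷ T.app a = 𝟙 (S.app a ≫ T.app a)
    simp
  tensorHom_comp_tensorHom {T₁ S₁ R₁ T₂ S₂ R₂} f₁ f₂ g₁ g₂ := by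
    apply hom_ext; intro a
    change (T₂.app a ◁ homApp f₁ a ≫ homApp f₂ a ▷ S₁.app a) ≫
        S₂.app a ◁ homApp g₁ a ≫ homApp g₂ a ▷ R₁.app a =
      T₂.app a ◁ (homApp f₁ a ≫ homApp g₁ a) ≫ (homApp f₂ a ≫ homApp g₂ a) ▷ R₁.app a
    simp [← whisker_exchange_assoc]
  whiskerLeft_id T S := Bicategory.id_whiskerRight (B := Pseudofunctor A A) S T
  id_whiskerRight T S := Bicategory.whiskerLeft_id (B := Pseudofunctor A A) S T
  associator_naturality f₁ f₂ f₃ := by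
    apply hom_ext; intro a
    change (_ ◁ (_ ◁ homApp f₁ a ≫ homApp f₂ a ▷ _) ≫ homApp f₃ a ▷ (_ ≫ _)) ≫
        (α_ _ _ _).inv =
      (α_ _ _ _).inv ≫ (_ ≫ _) ◁ homApp f₁ a ≫ (_ ◁ homApp f₂ a ≫ homApp f₃ a ▷ _) ▷ _
    simp
  leftUnitor_naturality f := Bicategory.rightUnitor_naturality (B := Pseudofunctor A A) f
  rightUnitor_naturality f := Bicategory.leftUnitor_naturality (B := Pseudofunctor A A) f
  pentagon W X Y Z := Bicategory.pentagon_inv (B := Pseudofunctor A A) Z Y X W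
  triangle X Y := by
    apply hom_ext; intro a
    change (α_ (Y.app a) (𝟙 a) (X.app a)).inv ≫ (ρ_ _).hom ▷ _ = _ ◁ (λ_ _).hom
    simp

instance : BraidedCategory (Dim A) where
  braiding T S := braidingIso T S
  braiding_naturality_right T S S' θ := by
    apply hom_ext; intro a
    exact (T.cell_naturality (homApp θ a))
  braiding_naturality_left θ T := by
    apply hom_ext; intro a
    exact (homApp_cell θ (T.app a))
  hexagon_forward T S R := by
    apply hom_ext; intro a
    change (α_ (R.app a) (S.app a) (T.app a)).inv ≫ (T.cell (R.app a ≫ S.app a)).hom ≫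
      (α_ _ _ _).inv = (R.app a ◁ (T.cell (S.app a)).hom) ≫ (α_ _ _ _).inv ≫ (T.cell (R.app a)).hom ▷ S.app a
    rw [cell_comp]; simp
  hexagon_reverse T S R := by
    apply hom_ext; intro a
    change (α_ (R.app a) (S.app a) (T.app a)).hom ≫
        ((α_ _ _ _).inv ≫ (S.cell (R.app a)).hom ▷ T.app a ≫ (α_ _ _ _).hom ≫
          S.app a ◁ (T.cell (R.app a)).hom ≫ (α_ _ _ _).inv) ≫ (α_ _ _ _).hom =
      (S.cell (R.app a)).hom ▷ T.app a ≫ (α_ _ _ _).hom ≫ S.app a ◁ (T.cell (R.app a)).hom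
    simp

end Dim
end Dim

section Data
variable {A : Type u₁} [Bicategory.{w₁, v₁} A] {B : Type u₂} [Bicategory.{w₂, v₂} B]
  {F : A ⥤ᵖ B} {G : B ⥤ᵖ A}

/-- The component `η_a : a → G F a`. -/
def unitApp (eta : Pseudofunctor.id A ⟶ F.comp G) (a : A) : a ⟶ G.obj (F.obj a) := eta.app a

/-- The naturality cell of `η : id ⇒ G F` at `f`. -/
def unitCell (eta : Pseudofunctor.id A ⟶ F.comp G) {a b : A} (f : a ⟶ b) :
    f ≫ unitApp eta b ≅ unitApp eta a ≫ G.map (F.map f) := eta.naturality f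

/-- The component `ε_b : F G b → b`. -/
def counitApp (eps : G.comp F ⟶ Pseudofunctor.id B) (b : B) : F.obj (G.obj b) ⟶ b := eps.app b

/-- The naturality cell of `ε : F G ⇒ id` at `f`. -/
def counitCell (eps : G.comp F ⟶ Pseudofunctor.id B) {a b : B} (f : a ⟶ b) :
    F.map (G.map f) ≫ counitApp eps b ≅ counitApp eps a ≫ f := eps.naturality f

/-- The zigzag `(ε * F) ∘ (F * η) : F ⇒ F`. -/
def zigzagLeft (eta : Pseudofunctor.id A ⟶ F.comp G) (eps : G.comp F ⟶ Pseudofunctor.id B) : F ⟶ F :=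
  postUnit eta F ≫ preCounit F eps

/-- The zigzag `(G * ε) ∘ (η * G) : G ⇒ G`. -/
def zigzagRight (eta : Pseudofunctor.id A ⟶ F.comp G) (eps : G.comp F ⟶ Pseudofunctor.id B) : G ⟶ G :=
  preUnit G eta ≫ postCounit eps G

/-- Components of an invertible modification. -/
def isoApp {P Q : A ⥤ᵖ B} {σ τ : P ⟶ Q} (Γ : σ ≅ τ) (a : A) : σ.app a ≅ τ.app a where
  hom := Γ.hom.as.app a
  inv := Γ.inv.as.app a
  hom_inv_id := congrArg (fun m => m.as.app a) Γ.hom_inv_id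
  inv_hom_id := congrArg (fun m => m.as.app a) Γ.inv_hom_id

/-- The component `ε_{F a} ∘ F(η_a) ≅ id` of a triangulator for `F`. -/
def leftApp {eta : Pseudofunctor.id A ⟶ F.comp G} {eps : G.comp F ⟶ Pseudofunctor.id B}
    (tri : zigzagLeft eta eps ≅ 𝟙 F) (a : A) :
    F.map (unitApp eta a) ≫ counitApp eps (F.obj a) ≅ 𝟙 (F.obj a) := isoApp tri a

/-- The component `G(ε_b) ∘ η_{G b} ≅ id` of a triangulator for `G`. -/
def rightApp {eta : Pseudofunctor.id A ⟶ F.comp G} {eps : G.comp F ⟶ Pseudofunctor.id B}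
    (tri : zigzagRight eta eps ≅ 𝟙 G) (b : B) :
    unitApp eta (G.obj b) ≫ G.map (counitApp eps b) ≅ 𝟙 (G.obj b) := isoApp tri b

/-- The component of a saddle `η ∘ η* ≅ id_{GF}`. -/
def saddleApp {eta : Pseudofunctor.id A ⟶ F.comp G} {etaStar : F.comp G ⟶ Pseudofunctor.id A}
    (s : etaStar ≫ eta ≅ 𝟙 (F.comp G)) (a : A) :
    counitApp etaStar a ≫ unitApp eta a ≅ 𝟙 (G.obj (F.obj a)) := isoApp s a

/-- Swallowtail rule at `ε`: the two ways of straightening the triple fold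
`ε ∘ (F G * ε) ∘ (F * η * G) ⇛ ε` agree. One applies `F * trir`; the other first interchanges
`ε ∘ (F G * ε)` with `ε ∘ (ε * F G)` (the naturality cell of `ε` at `ε_b`), then applies
`tril * G`. -/
def SwallowtailCounit {eta : Pseudofunctor.id A ⟶ F.comp G} {eps : G.comp F ⟶ Pseudofunctor.id B}
    (tril : zigzagLeft eta eps ≅ 𝟙 F) (trir : zigzagRight eta eps ≅ 𝟙 G) : Prop :=
  ∀ b : B,
    ((F.mapComp (unitApp eta (G.obj b)) (G.map (counitApp eps b))).inv ≫
        F.map₂ (rightApp trir b).hom ≫ (F.mapId (G.obj b)).hom) ▷ counitApp eps b ≫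
        (λ_ (counitApp eps b)).hom =
      (α_ _ _ _).hom ≫ F.map (unitApp eta (G.obj b)) ◁ (counitCell eps (counitApp eps b)).hom ≫
        (α_ _ _ _).inv ≫ (leftApp tril (G.obj b)).hom ▷ counitApp eps b ≫ (λ_ (counitApp eps b)).hom

/-- Swallowtail rule at `η`: the two ways of straightening
`(G * ε * F) ∘ (G F * η) ∘ η ⇛ η` agree. One applies `G * tril`; the other first interchanges
`(G F * η) ∘ η` with `(η * G F) ∘ η`, then applies `trir * F`. -/
def SwallowtailUnit {eta : Pseudofunctor.id A ⟶ F.comp G} {eps : G.comp F ⟶ Pseudofunctor.id B}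
    (tril : zigzagLeft eta eps ≅ 𝟙 F) (trir : zigzagRight eta eps ≅ 𝟙 G) : Prop :=
  ∀ a : A,
    unitApp eta a ◁ ((G.mapComp (F.map (unitApp eta a)) (counitApp eps (F.obj a))).inv ≫
        G.map₂ (leftApp tril a).hom ≫ (G.mapId (F.obj a)).hom) ≫ (ρ_ (unitApp eta a)).hom =
      (α_ _ _ _).inv ≫ (unitCell eta (unitApp eta a)).inv ▷ G.map (counitApp eps (F.obj a)) ≫
        (α_ _ _ _).hom ≫ unitApp eta a ◁ (rightApp trir (F.obj a)).hom ≫ (ρ_ (unitApp eta a)).hom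

/-- Horizontal cusp rule: the two modifications `ε * F ⇛ F * η*`, one through an inverse saddle
`s⁻¹` and the triangulator `tri`, the other through the inverse triangulator `tri'⁻¹` and the saddle
`s'`, agree. -/
def HorizontalCuspCounit {eta : Pseudofunctor.id A ⟶ F.comp G} {etaStar : F.comp G ⟶ Pseudofunctor.id A}
    {eps : G.comp F ⟶ Pseudofunctor.id B} {epsStar : Pseudofunctor.id B ⟶ G.comp F}
    (tri : zigzagLeft eta eps ≅ 𝟙 F) (tri' : zigzagRight epsStar etaStar ≅ 𝟙 F)
    (s : etaStar ≫ eta ≅ 𝟙 (F.comp G)) (s' : eps ≫ epsStar ≅ 𝟙 (G.comp F)) : Prop :=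
  ∀ a : A,
    (λ_ (counitApp eps (F.obj a))).inv ≫ ((F.mapId (G.obj (F.obj a))).inv ≫
        F.map₂ (saddleApp s a).inv ≫ (F.mapComp (counitApp etaStar a) (unitApp eta a)).hom) ▷
          counitApp eps (F.obj a) ≫
        (α_ _ _ _).hom ≫ F.map (counitApp etaStar a) ◁ (leftApp tri a).hom ≫
        (ρ_ (F.map (counitApp etaStar a))).hom =
      (ρ_ (counitApp eps (F.obj a))).inv ≫ counitApp eps (F.obj a) ◁ (rightApp tri' a).inv ≫
        (α_ _ _ _).inv ≫ (saddleApp s' (F.obj a)).hom ▷ F.map (counitApp etaStar a) ≫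
        (λ_ (F.map (counitApp etaStar a))).hom

/-- Horizontal cusp rule: the two modifications `F * η ⇛ ε* * F`, one through an inverse saddle
`s'⁻¹` and the triangulator `tri`, the other through the inverse triangulator `tri'⁻¹` and the saddle
`s`, agree. -/
def HorizontalCuspUnit {eta : Pseudofunctor.id A ⟶ F.comp G} {etaStar : F.comp G ⟶ Pseudofunctor.id A}
    {eps : G.comp F ⟶ Pseudofunctor.id B} {epsStar : Pseudofunctor.id B ⟶ G.comp F}
    (tri : zigzagLeft eta eps ≅ 𝟙 F) (tri' : zigzagRight epsStar etaStar ≅ 𝟙 F)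
    (s : etaStar ≫ eta ≅ 𝟙 (F.comp G)) (s' : eps ≫ epsStar ≅ 𝟙 (G.comp F)) : Prop :=
  ∀ a : A,
    (ρ_ (F.map (unitApp eta a))).inv ≫ F.map (unitApp eta a) ◁ (saddleApp s' (F.obj a)).inv ≫
        (α_ _ _ _).inv ≫ (leftApp tri a).hom ▷ unitApp epsStar (F.obj a) ≫
        (λ_ (unitApp epsStar (F.obj a))).hom =
      (λ_ (F.map (unitApp eta a))).inv ≫ (rightApp tri' a).inv ▷ F.map (unitApp eta a) ≫
        (α_ _ _ _).hom ≫ unitApp epsStar (F.obj a) ◁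
          ((F.mapComp (counitApp etaStar a) (unitApp eta a)).inv ≫ F.map₂ (saddleApp s a).hom ≫
            (F.mapId (G.obj (F.obj a))).hom) ≫
        (ρ_ (unitApp epsStar (F.obj a))).hom

theorem sandwich_id (G : B ⥤ᵖ A) {x y : A} {z w : B} (p : x ⟶ G.obj z) (q : z ⟶ w)
    (r : G.obj w ⟶ y) : p ◁ G.map₂ (𝟙 q) ▷ r = 𝟙 (p ≫ G.map q ≫ r) := by
  simp

theorem sandwich_comp (G : B ⥤ᵖ A) {x y : A} {z w : B} (p : x ⟶ G.obj z) {q q' q'' : z ⟶ w}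
    (α : q ⟶ q') (β : q' ⟶ q'') (r : G.obj w ⟶ y) :
    p ◁ G.map₂ (α ≫ β) ▷ r = p ◁ G.map₂ α ▷ r ≫ p ◁ G.map₂ β ▷ r := by
  simp

end Data

/-- Coherent adjoint equivalence of bicategories. Here `eta, etaStar, eps, epsStar` are
`η : id ⇒ GF`, `η* : GF ⇒ id`, `ε : FG ⇒ id`, `ε* : id ⇒ FG`; the `tri` are the four triangulators
of the two zigzag pairs `(η, ε)` and `(ε*, η*)`; `b, b'` are the births and `s, s'` the saddles. The
laws for the pair `(ε*, η*)` are those for `(η, ε)` with the roles of `F` and `G` exchanged. The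
births and saddles are not required to satisfy snake equations. -/
structure CoherentAdjointEquivalence (A : Type u₁) [Bicategory.{w₁, v₁} A]
    (B : Type u₂) [Bicategory.{w₂, v₂} B] where
  F : A ⥤ᵖ B
  G : B ⥤ᵖ A
  eta : Pseudofunctor.id A ⟶ F.comp G
  etaStar : F.comp G ⟶ Pseudofunctor.id A
  eps : G.comp F ⟶ Pseudofunctor.id B
  epsStar : Pseudofunctor.id B ⟶ G.comp F
  tri₁ : zigzagLeft eta eps ≅ 𝟙 F
  tri₂ : zigzagRight eta eps ≅ 𝟙 G
  tri₁' : zigzagRight epsStar etaStar ≅ 𝟙 F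
  tri₂' : zigzagLeft epsStar etaStar ≅ 𝟙 G
  b : 𝟙 (Pseudofunctor.id A) ≅ eta ≫ etaStar
  s : etaStar ≫ eta ≅ 𝟙 (F.comp G)
  b' : 𝟙 (Pseudofunctor.id B) ≅ epsStar ≫ eps
  s' : eps ≫ epsStar ≅ 𝟙 (G.comp F)
  swallowtail_eps : SwallowtailCounit tri₁ tri₂
  swallowtail_eta : SwallowtailUnit tri₁ tri₂
  swallowtail_etaStar : SwallowtailCounit tri₂' tri₁'
  swallowtail_epsStar : SwallowtailUnit tri₂' tri₁'
  cusp_eps : HorizontalCuspCounit tri₁ tri₁' s s'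
  cusp_eta : HorizontalCuspUnit tri₁ tri₁' s s'
  cusp_etaStar : HorizontalCuspCounit tri₂' tri₂ s' s
  cusp_epsStar : HorizontalCuspUnit tri₂' tri₂ s' s

namespace CoherentAdjointEquivalence

variable {A : Type u₁} [Bicategory.{w₁, v₁} A] {B : Type u₂} [Bicategory.{w₂, v₂} B]
  (E : CoherentAdjointEquivalence A B)

/-- `G * T * F : GF ⇒ GF`. -/
def conj (T : Dim B) : E.F.comp E.G ⟶ E.F.comp E.G := postWhisker (preEndo E.F T) E.G

/-- `G * θ * F`. -/
def conjMap {T S : Dim B} (θ : T ⟶ S) : E.conj T ⟶ E.conj S :=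
  postWhiskerMod (preEndoMod E.F θ) E.G

open MonoidalCategory in
/-- `(G * T * F) ∘ (G * S * F) ≅ G * (T ∘ S) * F`. -/
def conjComp (T S : Dim B) : E.conj S ≫ E.conj T ≅ E.conj (T ⊗ S) :=
  postWhiskerComp (preEndo E.F S) (preEndo E.F T) E.G

/-- The functor `K(T) = η* ∘ (G * T * F) ∘ η` from `Dim B` to `Dim A`. -/
def dimFunctor : Dim B ⥤ Dim A where
  obj T := E.eta ≫ E.conj T ≫ E.etaStar
  map θ := Bicategory.whiskerLeft E.eta (Bicategory.whiskerRight (E.conjMap θ) E.etaStar)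
  map_id T := by
    apply Dim.hom_ext; intro a
    exact sandwich_id E.G (unitApp E.eta a) (Dim.app T (E.F.obj a)) (counitApp E.etaStar a)
  map_comp θ κ := by
    apply Dim.hom_ext; intro a
    exact sandwich_comp E.G (unitApp E.eta a) (Dim.homApp θ (E.F.obj a))
      (Dim.homApp κ (E.F.obj a)) (counitApp E.etaStar a)

open MonoidalCategory in
/-- The modification `K(T) ∘ K(S) ⇛ K(T ∘ S)` given by the saddle `s : η ∘ η* ⇛ id` in the middle
of `η* ∘ (G * T * F) ∘ η ∘ η* ∘ (G * S * F) ∘ η`. -/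
def saddleCell (T S : Dim B) :
    E.dimFunctor.obj T ⊗ E.dimFunctor.obj S ⟶ E.dimFunctor.obj (T ⊗ S) :=
  show (E.eta ≫ E.conj S ≫ E.etaStar) ≫ (E.eta ≫ E.conj T ≫ E.etaStar) ⟶ E.eta ≫ E.conj (T ⊗ S) ≫ E.etaStar from
  (Bicategory.associator E.eta (E.conj S ≫ E.etaStar) (E.eta ≫ E.conj T ≫ E.etaStar)).hom ≫
    Bicategory.whiskerLeft E.eta
      ((Bicategory.associator (E.conj S) E.etaStar (E.eta ≫ E.conj T ≫ E.etaStar)).hom ≫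
        Bicategory.whiskerLeft (E.conj S)
          ((Bicategory.associator E.etaStar E.eta (E.conj T ≫ E.etaStar)).inv ≫
            Bicategory.whiskerRight E.s.hom (E.conj T ≫ E.etaStar) ≫
            (Bicategory.leftUnitor (E.conj T ≫ E.etaStar)).hom) ≫
        (Bicategory.associator (E.conj S) (E.conj T) E.etaStar).inv ≫
        Bicategory.whiskerRight (E.conjComp T S).hom E.etaStar)

end CoherentAdjointEquivalence

end HigherDimension

/-! The component of K(T) at a is the conjugate η*_a ∘ G(T_{Fa}) ∘ η_a, and F turns it back into
T_{Fa}. Indeed `tri₁` and the image of the saddle `s` make εF and Fη* inverses of Fη on opposite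
sides, so they are isomorphic; with Fη* replaced by εF, naturality of ε moves it past FG(T_{Fa}),
and `tri₁` cancels what remains. The resulting `straighten` gives the components of F * K(T) ≅ T * F
(`intertwiner`).

Since F is locally faithful (`map₂_injective`), an equation of 2-cells into a conjugate may be
tested after applying F and straightening. There the saddle constraint becomes horizontal
composition (`straighten_merge`), the unit constraint becomes that of F (`straighten_birth`), and
the cells of K(T) become cells of T (`straighten_cell`). The axioms of a braided monoidal functor
then reduce to interchange and naturality. The unit constraint needs a birth satisfying a snake
equation with `s`; the given `b` is not assumed to, so it is corrected with `s` kept fixed.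

For the equivalence, let L be the functor of the opposite data. Its straightening G * L(S) ≅ S * G,
restricted along F, turns K(L(S)) into η* ∘ (S * GF) ∘ η; interchanging S with η gives η* ∘ η ∘ S,
and `b` cancels η* ∘ η. -/

namespace HigherDimension

/-! ### Conjugation by a 1-cell with inverses on both sides -/

section Comparison
variable {C : Type u₁} [Bicategory.{w₁, v₁} C] {x y : C} {u : x ⟶ y} {e c : y ⟶ x}
  (δ : u ≫ e ≅ 𝟙 x) (σ : c ≫ u ≅ 𝟙 y)

/-- A right inverse `e` and a left inverse `c` of `u` (up to isomorphism) agree. -/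
def inverseComparison : c ≅ e :=
  (ρ_ c).symm ≪≫ whiskerLeftIso c δ.symm ≪≫ (α_ c u e).symm ≪≫ whiskerRightIso σ e ≪≫ λ_ e

/-- If `e` intertwines `M` with `T`, then the conjugate `u ≫ M ≫ c` is isomorphic to `T`. -/
def conjugateIso {M : y ⟶ y} {T : x ⟶ x} (N : M ≫ e ≅ e ≫ T) : u ≫ M ≫ c ≅ T :=
  whiskerLeftIso u (whiskerLeftIso M (inverseComparison δ σ) ≪≫ N) ≪≫ (α_ u e T).symm ≪≫
    whiskerRightIso δ T ≪≫ λ_ T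

/-- Composition of conjugates by cancelling `c ≫ u` in the middle. -/
def conjugateComp (M M' : y ⟶ y) : (u ≫ M ≫ c) ≫ (u ≫ M' ≫ c) ⟶ u ≫ (M ≫ M') ≫ c :=
  (α_ u (M ≫ c) (u ≫ M' ≫ c)).hom ≫ u ◁ ((α_ M c (u ≫ M' ≫ c)).hom ≫
    M ◁ ((α_ c u (M' ≫ c)).inv ≫ σ.hom ▷ (M' ≫ c) ≫ (λ_ (M' ≫ c)).hom) ≫ (α_ M M' c).inv)

/-- Intertwiners compose. -/
def intertwinerComp {M M' : y ⟶ y} {T T' : x ⟶ x} (N : M ≫ e ≅ e ≫ T) (N' : M' ≫ e ≅ e ≫ T') :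
    (M ≫ M') ≫ e ≅ e ≫ T ≫ T' :=
  α_ M M' e ≪≫ whiskerLeftIso M N' ≪≫ (α_ M e T').symm ≪≫ whiskerRightIso N T' ≪≫ α_ e T T'

theorem conjugateIso_natural {M M' : y ⟶ y} {T T' : x ⟶ x} (N : M ≫ e ≅ e ≫ T)
    (N' : M' ≫ e ≅ e ≫ T') (m : M ⟶ M') (t : T ⟶ T') (h : m ▷ e ≫ N'.hom = N.hom ≫ e ◁ t) :
    u ◁ m ▷ c ≫ (conjugateIso δ σ N').hom = (conjugateIso δ σ N).hom ≫ t := by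
  simp only [conjugateIso, Iso.trans_hom, whiskerLeftIso_hom, whiskerRightIso_hom, Iso.symm_hom]
  -- The comparison c ≅ e does not involve M, so m passes it by interchange and then meets the
  -- intertwiner, where `h` applies.
  have h1 : u ◁ m ▷ c ≫ u ◁ (M' ◁ (inverseComparison δ σ).hom ≫ N'.hom) =
      u ◁ (M ◁ (inverseComparison δ σ).hom ≫ N.hom) ≫ u ◁ e ◁ t := by
    simp only [← Bicategory.whiskerLeft_comp, Category.assoc, ← h, whisker_exchange_assoc]
  rw [reassoc_of% h1]
  simp only [Category.assoc, associator_inv_naturality_right_assoc, whisker_exchange_assoc]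
  simp

/-- The comparison begins with the inverse of δ, which cancels, leaving σ. This lets σ be traded for
δ although no triangle identity relates the two. -/
theorem inverseComparison_cancel :
    c ◁ δ.hom ≫ (ρ_ c).hom ≫ (inverseComparison δ σ).hom =
      (α_ c u e).inv ≫ σ.hom ▷ e ≫ (λ_ e).hom := by
  simp [inverseComparison]

/-- On the left c ≫ u is cancelled by σ. Sliding σ past the second intertwiner puts it next to e,
where `inverseComparison_cancel` replaces it by δ followed by the comparison; each factor then has
its own δ, as on the right. -/
theorem conjugateComp_conjugateIso {M M' : y ⟶ y} {T T' : x ⟶ x} (N : M ≫ e ≅ e ≫ T)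
    (N' : M' ≫ e ≅ e ≫ T') :
    conjugateComp σ M M' ≫ (conjugateIso δ σ (intertwinerComp N N')).hom =
      (conjugateIso δ σ N).hom ▷ (u ≫ M' ≫ c) ≫ T ◁ (conjugateIso δ σ N').hom := by
  -- The comparison, and below it the composite `X`, are made opaque so that `bicategory` treats
  -- them as atoms.
  obtain ⟨γ, hγ⟩ : ∃ γ, γ = (inverseComparison δ σ).hom := ⟨_, rfl⟩
  obtain ⟨X, hX⟩ : ∃ X : M' ≫ c ⟶ e ≫ T', X = M' ◁ γ ≫ N'.hom := ⟨_, rfl⟩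
  have hN : ∀ {M : y ⟶ y} {T : x ⟶ x} (N : M ≫ e ≅ e ≫ T), (conjugateIso δ σ N).hom =
      u ◁ (M ◁ γ ≫ N.hom) ≫ (α_ u e T).inv ≫ δ.hom ▷ T ≫ (λ_ T).hom := fun N => by rw [hγ]; rfl
  calc
    _ = 𝟙 ((u ≫ M ≫ c) ≫ u ≫ M' ≫ c) ⊗≫ (u ≫ M) ◁ (σ.hom ▷ (M' ≫ c) ≫ 𝟙 y ◁ X) ⊗≫ u ◁ N.hom ▷ T' ⊗≫
        δ.hom ▷ (T ≫ T') ⊗≫ 𝟙 _ := by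
      rw [hN, hX, conjugateComp, intertwinerComp]
      simp only [Iso.trans_hom, whiskerLeftIso_hom, whiskerRightIso_hom, Iso.symm_hom]
      bicategory
    _ = 𝟙 _ ⊗≫ (u ≫ M ≫ c) ◁ u ◁ X ⊗≫ (u ≫ M) ◁ ((α_ c u e).inv ≫ σ.hom ▷ e ≫ (λ_ e).hom) ▷ T' ⊗≫
        u ◁ N.hom ▷ T' ⊗≫ δ.hom ▷ (T ≫ T') ⊗≫ 𝟙 _ := by
      rw [← whisker_exchange]; bicategory
    _ = (u ≫ M ≫ c) ◁ (conjugateIso δ σ N').hom ≫ (conjugateIso δ σ N).hom ▷ T' ⊗≫ 𝟙 _ := by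
      rw [← inverseComparison_cancel, ← hγ, hN, hN, ← hX]; bicategory
    _ = _ := by
      rw [← whisker_exchange]; bicategory

/-- Expanding the comparison creates the inverse of δ; by interchange it may come first, and the
snake equation for β and σ removes both, leaving δ⁻¹ followed by δ. -/
theorem birth_conjugateIso (β : 𝟙 x ≅ u ≫ c) (h : leftZigzag β.hom σ.hom = (λ_ _).hom ≫ (ρ_ _).inv) :
    β.hom ≫ u ◁ (inverseComparison δ σ).hom ≫ δ.hom = 𝟙 _ := by
  have : β.hom ≫ u ◁ (inverseComparison δ σ).hom =
    𝟙 _ ⊗≫ (β.hom ▷ 𝟙 x ≫ (u ≫ c) ◁ δ.inv) ⊗≫ u ◁ σ.hom ▷ e ⊗≫ 𝟙 _ := by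
    simp only [inverseComparison, Iso.trans_hom, whiskerLeftIso_hom, whiskerRightIso_hom,
      Iso.symm_hom]
    bicategory
  rw [reassoc_of% this, ← whisker_exchange]
  calc
    _ = 𝟙 _ ⊗≫ δ.inv ⊗≫ leftZigzag β.hom σ.hom ▷ e ⊗≫ δ.hom := by
      rw [leftZigzag]; bicategory
    _ = δ.inv ≫ δ.hom := by
      rw [h]; bicategory
    _ = _ := δ.inv_hom_id

end Comparison

theorem whisker_exchange_triple {C : Type u₁} [Bicategory.{w₁, v₁} C] {x y z w : C}
    {X t : x ⟶ y} {Y t' : y ⟶ z} {Z t'' : z ⟶ w} (p : X ⟶ t) (q : Y ⟶ t') (r : Z ⟶ t'') :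
    X ◁ q ▷ Z ≫ X ◁ t' ◁ r ≫ p ▷ (t' ≫ t'') ≫ (α_ t t' t'').inv =
      (α_ X Y Z).inv ≫ p ▷ Y ▷ Z ≫ (t ◁ q) ▷ Z ≫ (t ≫ t') ◁ r := by
  have h : X ◁ q ▷ Z ≫ X ◁ t' ◁ r ≫ p ▷ (t' ≫ t'') =
      X ◁ (q ▷ Z ≫ t' ◁ r) ≫ p ▷ (t' ≫ t'') := by simp
  rw [reassoc_of% h, whisker_exchange_assoc]
  simp
-- This is the componentwise form of the naturality of K(L(S)) ≅ S: p is the straightening for the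
-- opposite data, n the interchange of η with S, and β the inverse birth.
theorem interchange_whisker_natural {C : Type u₁} [Bicategory.{w₁, v₁} C] {x y : C} {u : x ⟶ y}
    {c : y ⟶ x} {M M' R R' : y ⟶ y} {t t' : x ⟶ x} {m : M ⟶ M'} {r : R ⟶ R'} {θ : t ⟶ t'}
    {p : M ⟶ R} {p' : M' ⟶ R'} {n : u ≫ R ⟶ t ≫ u} {n' : u ≫ R' ⟶ t' ≫ u}
    (h : u ◁ (m ≫ p') ▷ c = u ◁ (p ≫ r) ▷ c) (hn : u ◁ r ≫ n' = n ≫ θ ▷ u) (β : u ≫ c ⟶ 𝟙 x) :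
    u ◁ m ▷ c ≫ u ◁ p' ▷ c ≫ (α_ _ _ _).inv ≫ n' ▷ c ≫ (α_ _ _ _).hom ≫ t' ◁ β ≫ (ρ_ t').hom =
      (u ◁ p ▷ c ≫ (α_ _ _ _).inv ≫ n ▷ c ≫ (α_ _ _ _).hom ≫ t ◁ β ≫ (ρ_ t).hom) ≫ θ := by
  have h' : u ◁ m ▷ c ≫ u ◁ p' ▷ c = u ◁ p ▷ c ≫ u ◁ r ▷ c := by simpa using h
  have hn' : (u ◁ r) ▷ c ≫ n' ▷ c = n ▷ c ≫ θ ▷ u ▷ c := by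
    rw [← comp_whiskerRight, hn, comp_whiskerRight]
  rw [reassoc_of% h', associator_inv_naturality_middle_assoc, reassoc_of% hn']
  simp only [Category.assoc, associator_naturality_left_assoc, ← whisker_exchange_assoc,
    rightUnitor_naturality]


/-! ### Interchange of ε with an endotransformation -/

section Intertwining
variable {A : Type u₁} [Bicategory.{w₁, v₁} A] {B : Type u₂} [Bicategory.{w₂, v₂} B]
  {F : A ⥤ᵖ B} {G : B ⥤ᵖ A}

/-- `K * σ` for `σ : id ⇒ id`, regarded as a transformation `K ⇒ K`. -/
def postEndo (K : A ⥤ᵖ B) (σ : Pseudofunctor.id A ⟶ Pseudofunctor.id A) : K ⟶ K :=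
  retype (postWhisker σ K) (id_comp K) (id_comp K) (fun a => K.map (σ.app a))
    (fun {a b} f => (K.mapComp f (σ.app b)).symm ≪≫ K.map₂Iso (σ.naturality f) ≪≫
      K.mapComp (σ.app a) f) HEq.rfl HEq.rfl

/-- `postWhisker` on invertible modifications. -/
def postWhiskerIso {C : Type u₃} [Bicategory.{w₃, v₃} C] {P Q : A ⥤ᵖ B} {σ τ : P ⟶ Q} (θ : σ ≅ τ)
    (K : B ⥤ᵖ C) : postWhisker σ K ≅ postWhisker τ K :=
  Pseudofunctor.StrongTrans.isoMk (fun a => K.map₂Iso (isoApp θ a))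
    (fun f => (postWhiskerMod θ.hom K).as.naturality f)

/-- `K * id ≅ id`. -/
def postWhiskerId {C : Type u₃} [Bicategory.{w₃, v₃} C] (P : A ⥤ᵖ B) (K : B ⥤ᵖ C) :
    postWhisker (𝟙 P) K ≅ 𝟙 (P.comp K) :=
  Pseudofunctor.StrongTrans.isoMk (fun a => K.mapId (P.obj a)) (by
    intro a b f
    change K.map (P.map f) ◁ (K.mapId (P.obj b)).hom ≫ (ρ_ _).hom ≫ (λ_ _).inv =
      ((K.mapComp (P.map f) (𝟙 _)).inv ≫ K.map₂ ((ρ_ _).hom ≫ (λ_ _).inv) ≫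
        (K.mapComp (𝟙 _) (P.map f)).hom) ≫ (K.mapId (P.obj a)).hom ▷ K.map (P.map f)
    have h : K.map₂ (λ_ (P.map f)).inv = (λ_ (K.map (P.map f))).inv ≫
        (K.mapId _).inv ▷ K.map (P.map f) ≫ (K.mapComp _ _).inv := by
      rw [← cancel_epi (K.map₂ (λ_ (P.map f)).hom), ← K.map₂_comp]
      simp
    simp [h])

theorem counitCell_naturality (eps : G.comp F ⟶ Pseudofunctor.id B) {x y : B} {f g : x ⟶ y}
    (β : f ⟶ g) :
    F.map₂ (G.map₂ β) ▷ counitApp eps y ≫ (counitCell eps g).hom =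
      (counitCell eps f).hom ≫ counitApp eps x ◁ β :=
  Pseudofunctor.StrongTrans.naturality_naturality eps β

theorem counitCell_id (eps : G.comp F ⟶ Pseudofunctor.id B) (x : B) :
    (counitCell eps (𝟙 x)).hom =
      (F.map₂ (G.mapId x).hom ≫ (F.mapId (G.obj x)).hom) ▷ counitApp eps x ≫
        (λ_ (counitApp eps x)).hom ≫ (ρ_ (counitApp eps x)).inv := by
  have h : (counitCell eps (𝟙 x)).hom ≫ counitApp eps x ◁ 𝟙 (𝟙 x) =
      (F.map₂ (G.mapId x).hom ≫ (F.mapId (G.obj x)).hom) ▷ counitApp eps x ≫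
        (λ_ (counitApp eps x)).hom ≫ (ρ_ (counitApp eps x)).inv :=
    Pseudofunctor.StrongTrans.naturality_id eps x
  simpa using h

theorem counitCell_comp (eps : G.comp F ⟶ Pseudofunctor.id B) {x y z : B} (f : x ⟶ y) (g : y ⟶ z) :
    (counitCell eps (f ≫ g)).hom =
      (F.map₂ (G.mapComp f g).hom ≫ (F.mapComp (G.map f) (G.map g)).hom) ▷ counitApp eps z ≫
        (α_ _ _ _).hom ≫ F.map (G.map f) ◁ (counitCell eps g).hom ≫ (α_ _ _ _).inv ≫
          (counitCell eps f).hom ▷ g ≫ (α_ _ _ _).hom := by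
  have h : (counitCell eps (f ≫ g)).hom ≫ counitApp eps x ◁ 𝟙 (f ≫ g) =
      (F.map₂ (G.mapComp f g).hom ≫ (F.mapComp (G.map f) (G.map g)).hom) ▷ counitApp eps z ≫
        (α_ _ _ _).hom ≫ F.map (G.map f) ◁ (counitCell eps g).hom ≫ (α_ _ _ _).inv ≫
          (counitCell eps f).hom ▷ g ≫ (α_ _ _ _).hom :=
    Pseudofunctor.StrongTrans.naturality_comp eps f g
  simpa using h

/-- `F G * T`, a transformation `F G ⇒ F G`. -/
def roundTrip (F : A ⥤ᵖ B) (G : B ⥤ᵖ A) (T : Dim B) : G.comp F ⟶ G.comp F :=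
  postWhisker (postEndo G T) F

/-- The interchange of `ε` and `T`. -/
def counitInterchange (eps : G.comp F ⟶ Pseudofunctor.id B) (T : Dim B) :
    roundTrip F G T ≫ eps ≅ eps ≫ T :=
  Pseudofunctor.StrongTrans.isoMk (fun x => counitCell eps (T.app x)) (by
    intro x y f
    change F.map (G.map f) ◁ (counitCell eps (T.app y)).hom ≫ (α_ _ _ _).inv ≫
        (counitCell eps f).hom ▷ T.app y ≫ (α_ _ _ _).hom ≫ counitApp eps x ◁ (T.cell f).hom ≫
        (α_ _ _ _).inv =
      ((α_ _ _ _).inv ≫ ((F.mapComp (G.map f) (G.map (T.app y))).inv ≫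
        F.map₂ ((G.mapComp f (T.app y)).inv ≫ G.map₂ (T.cell f).hom ≫ (G.mapComp (T.app x) f).hom) ≫
        (F.mapComp (G.map (T.app x)) (G.map f)).hom) ▷ counitApp eps y ≫ (α_ _ _ _).hom ≫
        F.map (G.map (T.app x)) ◁ (counitCell eps f).hom ≫ (α_ _ _ _).inv) ≫
        (counitCell eps (T.app x)).hom ▷ f
    -- The source and target of T(f) are composites, so naturality of ε at this 2-cell, expanded by
    -- the composition law for ε, is the modification axiom.
    have h := counitCell_naturality eps (T.cell f).hom
    rw [counitCell_comp, counitCell_comp] at h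
    simp only [Category.assoc] at h ⊢
    rw [← cancel_epi (α_ _ _ _).hom, ← cancel_epi ((F.map₂ (G.mapComp f (T.app y)).hom ≫
      (F.mapComp (G.map f) (G.map (T.app y))).hom) ▷ counitApp eps y),
      ← cancel_mono (α_ _ _ _).hom]
    simp only [Category.assoc] at h ⊢
    have hcancel : ∀ {p : F.obj (G.obj x) ⟶ y} (Z : F.map (G.map (f ≫ T.app y)) ≫ counitApp eps y ⟶ p),
        F.map₂ (G.mapComp f (T.app y)).hom ▷ counitApp eps y ≫
          F.map₂ (G.mapComp f (T.app y)).inv ▷ counitApp eps y ≫ Z = Z := fun Z => by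
      rw [← Bicategory.comp_whiskerRight_assoc, ← F.map₂_comp]
      simp
    simpa [hcancel] using h.symm)

/-- `counitInterchange` restricted along `F`. -/
def counitInterchangeAt (eps : G.comp F ⟶ Pseudofunctor.id B) (T : Dim B) :
    preWhisker F (roundTrip F G T) ≫ preCounit F eps ≅ preCounit F eps ≫ preEndo F T :=
  Pseudofunctor.StrongTrans.isoMk (fun a => counitCell eps (T.app (F.obj a)))
    (fun f => (counitInterchange eps T).hom.as.naturality (F.map f))

end Intertwining

/-! ### The opposite data and the isomorphism F * K(T) ≅ T * F -/

namespace CoherentAdjointEquivalence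

variable {A : Type u₁} [Bicategory.{w₁, v₁} A] {B : Type u₂} [Bicategory.{w₂, v₂} B]
  (E : CoherentAdjointEquivalence A B)

/-- The opposite coherent adjoint equivalence. -/
def symm : CoherentAdjointEquivalence B A where
  F := E.G
  G := E.F
  eta := E.epsStar
  etaStar := E.eps
  eps := E.etaStar
  epsStar := E.eta
  tri₁ := E.tri₂'
  tri₂ := E.tri₁'
  tri₁' := E.tri₂
  tri₂' := E.tri₁
  b := E.b'
  s := E.s'
  b' := E.b
  s' := E.s
  swallowtail_eps := E.swallowtail_etaStar
  swallowtail_eta := E.swallowtail_epsStar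
  swallowtail_etaStar := E.swallowtail_eps
  swallowtail_epsStar := E.swallowtail_eta
  cusp_eps := E.cusp_etaStar
  cusp_eta := E.cusp_epsStar
  cusp_etaStar := E.cusp_eps
  cusp_epsStar := E.cusp_eta

/-- `F * K(T)` splits as a composite of three transformations. -/
def postEndoObjIso (T : Dim B) :
    postEndo E.F (E.dimFunctor.obj T) ≅
      postUnit E.eta E.F ≫ preWhisker E.F (roundTrip E.F E.G T) ≫ postCounit E.etaStar E.F :=
  -- `W` lies between 2-functors equal to the required ones by `id_comp` and `comp_assoc`, not by
  -- unfolding; the modification is therefore rebuilt from its components, whose cells do agree.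
  let W : postWhisker (E.eta ≫ E.conj T ≫ E.etaStar) E.F ≅ postWhisker E.eta E.F ≫
      postWhisker (E.conj T) E.F ≫ postWhisker E.etaStar E.F :=
    (postWhiskerComp E.eta (E.conj T ≫ E.etaStar) E.F).symm ≪≫
      whiskerLeftIso _ (postWhiskerComp (E.conj T) E.etaStar E.F).symm
  Pseudofunctor.StrongTrans.isoMk (fun a => isoApp W a) (fun f => W.hom.as.naturality f)

/-- `F * s`. -/
def postSaddle : postCounit E.etaStar E.F ≫ postUnit E.eta E.F ≅ 𝟙 (E.F.comp (E.G.comp E.F)) :=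
  let W : postWhisker E.etaStar E.F ≫ postWhisker E.eta E.F ≅ 𝟙 ((E.F.comp E.G).comp E.F) :=
    postWhiskerComp E.etaStar E.eta E.F ≪≫ postWhiskerIso E.s E.F ≪≫ postWhiskerId _ E.F
  Pseudofunctor.StrongTrans.isoMk (fun a => isoApp W a) (fun f => W.hom.as.naturality f)

/-- `F * K(T) ≅ T * F`. -/
def intertwiner (T : Dim B) : postEndo E.F (E.dimFunctor.obj T) ≅ preEndo E.F T :=
  E.postEndoObjIso T ≪≫ conjugateIso E.tri₁ E.postSaddle (counitInterchangeAt E.eps T)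

end CoherentAdjointEquivalence

/-! ### Images of conjugates under a weak 2-functor -/

section MapTriple
variable {A : Type u₁} [Bicategory.{w₁, v₁} A] {B : Type u₂} [Bicategory.{w₂, v₂} B] (F : A ⥤ᵖ B)

/-- The image of a triple composite. -/
def mapTriple {p q r s : A} (u : p ⟶ q) (M : q ⟶ r) (c : r ⟶ s) :
    F.map (u ≫ M ≫ c) ≅ F.map u ≫ F.map M ≫ F.map c :=
  F.mapComp u (M ≫ c) ≪≫ whiskerLeftIso (F.map u) (F.mapComp M c)

theorem mapTriple_natural {p q r s : A} (u : p ⟶ q) {M M' : q ⟶ r} (m : M ⟶ M') (c : r ⟶ s) :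
    F.map₂ (u ◁ m ▷ c) ≫ (mapTriple F u M' c).hom =
      (mapTriple F u M c).hom ≫ F.map u ◁ F.map₂ m ▷ F.map c := by
  simp [mapTriple]

/-- The image of an isomorphism `c ≫ u ≅ 𝟙`. -/
def mapCancel {y p : A} {c : y ⟶ p} {u : p ⟶ y} (σ : c ≫ u ≅ 𝟙 y) :
    F.map c ≫ F.map u ≅ 𝟙 (F.obj y) :=
  (F.mapComp c u).symm ≪≫ F.map₂Iso σ ≪≫ F.mapId y

theorem map₂_leftUnitor_inv {a b : A} (f : a ⟶ b) : F.map₂ (λ_ f).inv =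
    (λ_ (F.map f)).inv ≫ (F.mapId a).inv ▷ F.map f ≫ (F.mapComp (𝟙 a) f).inv := by
  rw [← cancel_epi (F.map₂ (λ_ f).hom), ← F.map₂_comp]
  simp

theorem mapTriple_conjugateComp {x y : A} {u : x ⟶ y} {c : y ⟶ x} (σ : c ≫ u ≅ 𝟙 y)
    (M M' : y ⟶ y) :
    F.map₂ (conjugateComp σ M M') ≫ (mapTriple F u (M ≫ M') c).hom =
      (F.mapComp (u ≫ M ≫ c) (u ≫ M' ≫ c)).hom ≫
        (mapTriple F u M c).hom ▷ F.map (u ≫ M' ≫ c) ≫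
          (F.map u ≫ F.map M ≫ F.map c) ◁ (mapTriple F u M' c).hom ≫
            conjugateComp (mapCancel F σ) (F.map M) (F.map M') ≫
              F.map u ◁ (F.mapComp M M').inv ▷ F.map c := by
  simp [mapTriple, mapCancel, conjugateComp, map₂_associator_inv]
  -- The only part needing an argument: the constraint of F at M' ≫ c is moved across the
  -- cancellation of c ≫ u.
  have key : (F.mapComp c u).inv ▷ F.map (M' ≫ c) ≫ F.map (c ≫ u) ◁ (F.mapComp M' c).hom ≫
      (α_ _ _ _).inv ≫ F.map₂ σ.hom ▷ F.map M' ▷ F.map c ≫ (α_ _ _ _).hom ≫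
      F.map (𝟙 y) ◁ (F.mapComp M' c).inv ≫ (F.mapId y).hom ▷ F.map (M' ≫ c) ≫
      (λ_ _).hom ≫ (F.mapComp M' c).hom =
    (F.map c ≫ F.map u) ◁ (F.mapComp M' c).hom ≫ (α_ _ _ _).inv ≫
      (F.mapComp c u).inv ▷ F.map M' ▷ F.map c ≫ F.map₂ σ.hom ▷ F.map M' ▷ F.map c ≫
      (F.mapId y).hom ▷ F.map M' ▷ F.map c ≫ (α_ _ _ _).hom ≫ (λ_ _).hom := by
    rw [← leftUnitor_naturality, ← whisker_exchange_assoc, ← whisker_exchange_assoc]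
    simp
  have key' := congrArg (fun t => F.map u ◁ F.map M ◁ ((α_ (F.map c) (F.map u) _).inv ≫ t)) key
  simp only [Bicategory.whiskerLeft_comp, comp_whiskerLeft, Category.assoc,
    Iso.inv_hom_id_assoc] at key'
  simp [reassoc_of% key']

end MapTriple

/-! ### Straightening, and local faithfulness of F -/

namespace CoherentAdjointEquivalence

variable {A : Type u₁} [Bicategory.{w₁, v₁} A] {B : Type u₂} [Bicategory.{w₂, v₂} B]
  (E : CoherentAdjointEquivalence A B)

/-- The isomorphism `F(η*_a ∘ G t ∘ η_a) ≅ t`. -/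
def straighten (a : A) (t : E.F.obj a ⟶ E.F.obj a) :
    E.F.map (unitApp E.eta a ≫ E.G.map t ≫ counitApp E.etaStar a) ≅ t :=
  mapTriple E.F _ _ _ ≪≫ conjugateIso (leftApp E.tri₁ a) (mapCancel E.F (saddleApp E.s a))
    (counitCell E.eps t)

theorem straighten_natural (a : A) {t t' : E.F.obj a ⟶ E.F.obj a} (β : t ⟶ t') :
    E.F.map₂ (unitApp E.eta a ◁ E.G.map₂ β ▷ counitApp E.etaStar a) ≫ (E.straighten a t').hom =
      (E.straighten a t).hom ≫ β := by
  simp only [straighten, Iso.trans_hom, Category.assoc, reassoc_of% mapTriple_natural]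
  rw [conjugateIso_natural _ _ _ _ _ _ (counitCell_naturality E.eps β)]

/-- The cell `(η* ∘ G t' ∘ η) ∘ (η* ∘ G t ∘ η) ⇒ η* ∘ G (t' ∘ t) ∘ η` given by the saddle. -/
def merge (a : A) (t t' : E.F.obj a ⟶ E.F.obj a) :
    (unitApp E.eta a ≫ E.G.map t ≫ counitApp E.etaStar a) ≫
        (unitApp E.eta a ≫ E.G.map t' ≫ counitApp E.etaStar a) ⟶
      unitApp E.eta a ≫ E.G.map (t ≫ t') ≫ counitApp E.etaStar a :=
  conjugateComp (saddleApp E.s a) (E.G.map t) (E.G.map t') ≫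
    unitApp E.eta a ◁ (E.G.mapComp t t').inv ▷ counitApp E.etaStar a

/-- The cell of ε at t ≫ t' is the composite intertwiner up to constraints of F and G, so
`conjugateComp_conjugateIso` splits the straightening into one for each factor. -/
theorem straighten_merge (a : A) (t t' : E.F.obj a ⟶ E.F.obj a) :
    E.F.map₂ (E.merge a t t') ≫ (E.straighten a (t ≫ t')).hom =
      (E.F.mapComp _ _).hom ≫ (E.straighten a t).hom ▷ _ ≫ t ◁ (E.straighten a t').hom := by
  -- The composition law of ε in the shape required by `conjugateIso_natural`, with an identity in
  -- place of `t`.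
  have h : ((E.F.mapComp (E.G.map t) (E.G.map t')).inv ≫ E.F.map₂ (E.G.mapComp t t').inv) ▷
      counitApp E.eps (E.F.obj a) ≫ (counitCell E.eps (t ≫ t')).hom =
      (intertwinerComp (counitCell E.eps t) (counitCell E.eps t')).hom ≫
        counitApp E.eps (E.F.obj a) ◁ 𝟙 _ := by
    have hcancel : E.F.map₂ (E.G.mapComp t t').inv ≫ E.F.map₂ (E.G.mapComp t t').hom = 𝟙 _ := by
      rw [← E.F.map₂_comp]; simp
    rw [counitCell_comp, ← comp_whiskerRight_assoc, Category.assoc, reassoc_of% hcancel]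
    simp [intertwinerComp]
  have h2 := conjugateIso_natural (leftApp E.tri₁ a) (mapCancel E.F (saddleApp E.s a)) _ _ _ _ h
  simp only [straighten, merge, Iso.trans_hom, PrelaxFunctor.map₂_comp, Category.assoc,
    reassoc_of% mapTriple_natural, reassoc_of% mapTriple_conjugateComp]
  simp only [Category.comp_id, comp_whiskerRight, Bicategory.whiskerLeft_comp, Category.assoc] at h2
  rw [h2, conjugateComp_conjugateIso]
  simp only [comp_whiskerRight, Bicategory.whiskerLeft_comp, Category.assoc, whisker_exchange_assoc]

theorem straighten_birth (a : A) (β : 𝟙 a ≅ unitApp E.eta a ≫ counitApp E.etaStar a)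
    (h : leftZigzag β.hom (saddleApp E.s a).hom = (λ_ _).hom ≫ (ρ_ _).inv) :
    E.F.map₂ (β.hom ≫ unitApp E.eta a ◁ ((λ_ (counitApp E.etaStar a)).inv ≫
        (E.G.mapId (E.F.obj a)).inv ▷ counitApp E.etaStar a)) ≫ (E.straighten a (𝟙 _)).hom =
      (E.F.mapId a).hom := by
  -- Since β and the saddle are invertible, one snake equation implies the other. The image of this
  -- adjunction under F supplies the snake equation for `birth_conjugateIso`.
  let adj : Adjunction (unitApp E.eta a) (counitApp E.etaStar a) :=
    ⟨β.hom, (saddleApp E.s a).hom, h, right_triangle_of_left_triangle _ _ h⟩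
  let β' : 𝟙 (E.F.obj a) ≅ E.F.map (unitApp E.eta a) ≫ E.F.map (counitApp E.etaStar a) :=
    (E.F.mapId a).symm ≪≫ E.F.map₂Iso β ≪≫ E.F.mapComp _ _
  have hβ : (E.F.mapId a).inv ≫ E.F.map₂ β.hom ≫ (E.F.mapComp _ _).hom ≫
      E.F.map (unitApp E.eta a) ◁
        (inverseComparison (leftApp E.tri₁ a) (mapCancel E.F (saddleApp E.s a))).hom ≫
        (leftApp E.tri₁ a).hom = 𝟙 _ := by
    simpa [β'] using birth_conjugateIso (leftApp E.tri₁ a) (mapCancel E.F (saddleApp E.s a)) β'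
      (E.F.mapAdjunction adj).left_triangle
  have hN : ((E.F.mapId _).inv ≫ E.F.map₂ (E.G.mapId _).inv) ▷ counitApp E.eps (E.F.obj a) ≫
      (counitCell E.eps (𝟙 (E.F.obj a))).hom =
      (λ_ (counitApp E.eps (E.F.obj a)) ≪≫ (ρ_ _).symm).hom ≫
        counitApp E.eps (E.F.obj a) ◁ 𝟙 _ := by
    have hcancel : E.F.map₂ (E.G.mapId (E.F.obj a)).inv ≫ E.F.map₂ (E.G.mapId (E.F.obj a)).hom =
        𝟙 _ := by
      rw [← E.F.map₂_comp]; simp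
    rw [counitCell_id, ← comp_whiskerRight_assoc, Category.assoc, reassoc_of% hcancel]
    simp
  have h2 := conjugateIso_natural (leftApp E.tri₁ a) (mapCancel E.F (saddleApp E.s a)) _ _ _ _ hN
  have h3 : (conjugateIso (leftApp E.tri₁ a) (mapCancel E.F (saddleApp E.s a))
      (λ_ (counitApp E.eps (E.F.obj a)) ≪≫ (ρ_ _).symm)).hom =
      E.F.map (unitApp E.eta a) ◁ (λ_ _).hom ≫ E.F.map (unitApp E.eta a) ◁
        (inverseComparison (leftApp E.tri₁ a) (mapCancel E.F (saddleApp E.s a))).hom ≫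
        (leftApp E.tri₁ a).hom := by
    simp [conjugateIso, id_whiskerLeft]
  simp only [comp_whiskerRight, Bicategory.whiskerLeft_comp, Category.assoc, h3,
    Category.comp_id] at h2
  rw [← cancel_epi (E.F.mapId a).inv, Iso.inv_hom_id, ← hβ]
  simp only [straighten, Iso.trans_hom, PrelaxFunctor.map₂_comp, Category.assoc,
    Bicategory.whiskerLeft_comp, reassoc_of% mapTriple_natural]
  rw [← cancel_epi (E.F.map (unitApp E.eta a) ◁ (E.F.mapId _).hom ▷ _)] at h2
  simp only [← Bicategory.whiskerLeft_comp_assoc, ← comp_whiskerRight,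
    Iso.hom_inv_id_assoc] at h2
  simp at h2
  rw [h2]
  simp [mapTriple, map₂_leftUnitor_inv]

/-- The cell of `K(T)` at `f`. -/
def objCell (T : Dim B) {a b : A} (f : a ⟶ b) :
    f ≫ unitApp E.eta b ≫ E.G.map (T.app (E.F.obj b)) ≫ counitApp E.etaStar b ≅
      (unitApp E.eta a ≫ E.G.map (T.app (E.F.obj a)) ≫ counitApp E.etaStar a) ≫ f :=
  (E.dimFunctor.obj T).cell f

/-- The components of `intertwiner` unfold to `straighten`, so this is its modification axiom. It is
the input for the braiding. -/
theorem straighten_cell (T : Dim B) {a b : A} (f : a ⟶ b) :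
    E.F.map f ◁ (E.straighten b (T.app (E.F.obj b))).hom ≫ (T.cell (E.F.map f)).hom =
      ((E.F.mapComp f _).inv ≫ E.F.map₂ (E.objCell T f).hom ≫ (E.F.mapComp _ f).hom) ≫
        (E.straighten a (T.app (E.F.obj a))).hom ▷ E.F.map f :=
  (E.intertwiner T).hom.as.naturality f

/-- `F` is locally faithful. -/
theorem map₂_injective {a b : A} {f g : a ⟶ b} {α β : f ⟶ g} (h : E.F.map₂ α = E.F.map₂ β) :
    α = β := by
  -- Naturality of η recovers γ ▷ η_b from GFγ; the birth then exhibits η_b as having a retraction,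
  -- which removes the whiskering.
  have hη : ∀ γ : f ⟶ g, γ ▷ unitApp E.eta b ≫ (unitCell E.eta g).hom =
      (unitCell E.eta f).hom ≫ unitApp E.eta a ◁ E.G.map₂ (E.F.map₂ γ) := fun γ =>
    Pseudofunctor.StrongTrans.naturality_naturality E.eta γ
  have h1 : α ▷ unitApp E.eta b = β ▷ unitApp E.eta b := by
    rw [← cancel_mono (unitCell E.eta g).hom, hη, hη, h]
  have hb : 𝟙 b ≅ unitApp E.eta b ≫ counitApp E.etaStar b := isoApp E.b b
  have h2 : α ▷ (unitApp E.eta b ≫ counitApp E.etaStar b) =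
      β ▷ (unitApp E.eta b ≫ counitApp E.etaStar b) := by
    simp [whiskerRight_comp, h1]
  have h3 : α ▷ 𝟙 b = β ▷ 𝟙 b := by
    rw [← cancel_mono (g ◁ hb.hom), ← whisker_exchange, ← whisker_exchange, h2]
  simpa using h3

end CoherentAdjointEquivalence
-- Coherence of the saddle constraint, checked after straightening
namespace CoherentAdjointEquivalence

variable {A : Type u₁} [Bicategory.{w₁, v₁} A] {B : Type u₂} [Bicategory.{w₂, v₂} B]
  (E : CoherentAdjointEquivalence A B)

/-- The 1-cell `η*_a ∘ G t ∘ η_a`. -/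
abbrev conjugate (a : A) (t : E.F.obj a ⟶ E.F.obj a) : a ⟶ a :=
  unitApp E.eta a ≫ E.G.map t ≫ counitApp E.etaStar a

/-- `conjugate` on 2-cells. -/
abbrev conjugateMap (a : A) {t t' : E.F.obj a ⟶ E.F.obj a} (β : t ⟶ t') :
    E.conjugate a t ⟶ E.conjugate a t' :=
  unitApp E.eta a ◁ E.G.map₂ β ▷ counitApp E.etaStar a

/-- 2-cells into a conjugate are determined by their straightenings. -/
theorem conjugate_hom_ext {a : A} {f : a ⟶ a} {t : E.F.obj a ⟶ E.F.obj a}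
    {α β : f ⟶ E.conjugate a t}
    (h : E.F.map₂ α ≫ (E.straighten a t).hom = E.F.map₂ β ≫ (E.straighten a t).hom) : α = β :=
  E.map₂_injective ((cancel_mono _).1 h)

theorem straighten_merge_left (a : A) {f : a ⟶ a} (t t' : E.F.obj a ⟶ E.F.obj a)
    (θ : f ⟶ E.conjugate a t') :
    E.F.map₂ (E.conjugate a t ◁ θ ≫ E.merge a t t') ≫ (E.straighten a (t ≫ t')).hom =
      (E.F.mapComp _ _).hom ≫ (E.straighten a t).hom ▷ E.F.map f ≫
        t ◁ (E.F.map₂ θ ≫ (E.straighten a t').hom) := by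
  rw [PrelaxFunctor.map₂_comp, Category.assoc, straighten_merge, Bicategory.whiskerLeft_comp,
    ← whisker_exchange_assoc, E.F.map₂_whisker_left]
  simp only [Category.assoc, Iso.inv_hom_id_assoc]

theorem straighten_merge_right (a : A) {f : a ⟶ a} (t t' : E.F.obj a ⟶ E.F.obj a)
    (θ : f ⟶ E.conjugate a t) :
    E.F.map₂ (θ ▷ E.conjugate a t' ≫ E.merge a t t') ≫ (E.straighten a (t ≫ t')).hom =
      (E.F.mapComp _ _).hom ≫ (E.F.map₂ θ ≫ (E.straighten a t).hom) ▷ _ ≫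
        t ◁ (E.straighten a t').hom := by
  rw [PrelaxFunctor.map₂_comp, Category.assoc, straighten_merge, E.F.map₂_whisker_right]
  simp only [Category.assoc, Iso.inv_hom_id_assoc, comp_whiskerRight]

theorem merge_natural_left (a : A) {t t' : E.F.obj a ⟶ E.F.obj a} (β : t ⟶ t')
    (r : E.F.obj a ⟶ E.F.obj a) :
    E.conjugate a r ◁ E.conjugateMap a β ≫ E.merge a r t' =
      E.merge a r t ≫ E.conjugateMap a (r ◁ β) := by
  apply E.conjugate_hom_ext
  rw [straighten_merge_left, straighten_natural, PrelaxFunctor.map₂_comp, Category.assoc,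
    straighten_natural, reassoc_of% straighten_merge]
  simp

theorem merge_natural_right (a : A) {t t' : E.F.obj a ⟶ E.F.obj a} (β : t ⟶ t')
    (r : E.F.obj a ⟶ E.F.obj a) :
    E.conjugateMap a β ▷ E.conjugate a r ≫ E.merge a t' r =
      E.merge a t r ≫ E.conjugateMap a (β ▷ r) := by
  apply E.conjugate_hom_ext
  rw [straighten_merge_right, straighten_natural, PrelaxFunctor.map₂_comp, Category.assoc,
    straighten_natural, reassoc_of% straighten_merge, comp_whiskerRight, Category.assoc,
    ← whisker_exchange]

theorem merge_assoc (a : A) (t t' t'' : E.F.obj a ⟶ E.F.obj a) :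
    E.conjugate a t ◁ E.merge a t' t'' ≫ E.merge a t (t' ≫ t'') ≫
        E.conjugateMap a (α_ t t' t'').inv =
      (α_ _ _ _).inv ≫ E.merge a t t' ▷ E.conjugate a t'' ≫ E.merge a (t ≫ t') t'' := by
  apply E.conjugate_hom_ext
  rw [← Category.assoc, PrelaxFunctor.map₂_comp, Category.assoc, straighten_natural,
    reassoc_of% straighten_merge_left, straighten_merge, PrelaxFunctor.map₂_comp, Category.assoc,
    straighten_merge_right, straighten_merge]
  simp only [map₂_associator_inv, Bicategory.whiskerLeft_comp, comp_whiskerRight, Category.assoc,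
    Iso.inv_hom_id_assoc, inv_hom_whiskerRight_assoc, ← whisker_exchange_assoc]
  rw [whisker_exchange_triple]

/-- The unit cell of the monoidal structure, for a birth `β`. -/
def unitCellOf (a : A) (β : 𝟙 a ⟶ unitApp E.eta a ≫ counitApp E.etaStar a) :
    𝟙 a ⟶ E.conjugate a (𝟙 _) :=
  β ≫ unitApp E.eta a ◁ ((λ_ (counitApp E.etaStar a)).inv ≫
        (E.G.mapId (E.F.obj a)).inv ▷ counitApp E.etaStar a)

theorem merge_unit_left (a : A) (t : E.F.obj a ⟶ E.F.obj a)
    (β : 𝟙 a ≅ unitApp E.eta a ≫ counitApp E.etaStar a)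
    (h : leftZigzag β.hom (saddleApp E.s a).hom = (λ_ _).hom ≫ (ρ_ _).inv) :
    E.conjugate a t ◁ E.unitCellOf a β.hom ≫ E.merge a t (𝟙 _) ≫ E.conjugateMap a (ρ_ t).hom =
      (ρ_ (E.conjugate a t)).hom := by
  apply E.conjugate_hom_ext
  rw [← Category.assoc, PrelaxFunctor.map₂_comp, Category.assoc, straighten_natural,
    reassoc_of% straighten_merge_left, unitCellOf, straighten_birth _ _ _ h]
  rw [← whisker_exchange_assoc, rightUnitor_naturality]
  simp only [Pseudofunctor.map₂_right_unitor, Category.assoc]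

theorem merge_unit_right (a : A) (t : E.F.obj a ⟶ E.F.obj a)
    (β : 𝟙 a ≅ unitApp E.eta a ≫ counitApp E.etaStar a)
    (h : leftZigzag β.hom (saddleApp E.s a).hom = (λ_ _).hom ≫ (ρ_ _).inv) :
    E.unitCellOf a β.hom ▷ E.conjugate a t ≫ E.merge a (𝟙 _) t ≫ E.conjugateMap a (λ_ t).hom =
      (λ_ (E.conjugate a t)).hom := by
  apply E.conjugate_hom_ext
  rw [← Category.assoc, PrelaxFunctor.map₂_comp, Category.assoc, straighten_natural,
    reassoc_of% straighten_merge_right, unitCellOf, straighten_birth _ _ _ h]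
  simp

/-- Apply `straighten_cell` to the 1-cell K(S)_a itself. After straightening, the claim is
naturality of T along the straightening of K(S)_a. -/
theorem merge_braiding (T S : Dim B) (a : A) :
    E.merge a (S.app (E.F.obj a)) (T.app (E.F.obj a)) ≫
        E.conjugateMap a (T.cell (S.app (E.F.obj a))).hom =
      (E.objCell T (E.conjugate a (S.app (E.F.obj a)))).hom ≫
        E.merge a (T.app (E.F.obj a)) (S.app (E.F.obj a)) := by
  apply E.conjugate_hom_ext
  have h := E.straighten_cell T (E.conjugate a (S.app (E.F.obj a)))
  simp only [Category.assoc] at h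
  rw [PrelaxFunctor.map₂_comp, Category.assoc, straighten_natural, reassoc_of% straighten_merge,
    PrelaxFunctor.map₂_comp, Category.assoc, straighten_merge, ← cancel_epi (E.F.mapComp _ _).inv,
    ← reassoc_of% h, ← T.cell_naturality, whisker_exchange_assoc]
  simp

end CoherentAdjointEquivalence
-- The corrected birth and the braided monoidal structure
namespace CoherentAdjointEquivalence

variable {A : Type u₁} [Bicategory.{w₁, v₁} A] {B : Type u₂} [Bicategory.{w₂, v₂} B]
  (E : CoherentAdjointEquivalence A B)

/-- The saddle as the unit of an adjoint equivalence between `η*` and `η`. -/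
noncomputable def saddleEquivalence : E.F.comp E.G ≌ Pseudofunctor.id A :=
  -- The unit s⁻¹ is kept and only the counit is modified, because the constraint of K is prescribed
  -- by s.
  Bicategory.Equivalence.mkOfAdjointifyCounit E.s.symm E.b.symm

/-- A birth satisfying the snake equations with the saddle. -/
noncomputable def snakeBirth : 𝟙 (Pseudofunctor.id A) ≅ E.eta ≫ E.etaStar :=
  E.saddleEquivalence.counit.symm

/-- The component of `snakeBirth`. -/
noncomputable def snakeBirthApp (a : A) : 𝟙 a ≅ unitApp E.eta a ≫ counitApp E.etaStar a :=
  isoApp E.snakeBirth a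

theorem leftZigzag_snakeBirthApp (a : A) :
    leftZigzag (E.snakeBirthApp a).hom (saddleApp E.s a).hom = (λ_ _).hom ≫ (ρ_ _).inv := by
  have h : leftZigzag E.snakeBirth.hom E.s.hom = (λ_ E.eta).hom ≫ (ρ_ E.eta).inv := by
    -- Unit and counit are the inverses of saddle and birth, so inverting the right triangle gives
    -- the left zigzag of birth and saddle.
    have h := congrArg Iso.inv E.saddleEquivalence.right_triangle
    rw [rightZigzagIso_inv] at h
    exact h.trans (by simp; rfl)
  have h2 := congrArg (fun m => m.as.app a) h
  simp only [leftZigzag, bicategoricalComp] at h2 ⊢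
  simp at h2 ⊢
  exact h2

/-- `G * id * F ≅ id`. -/
def conjId : E.conj (𝟙 (Pseudofunctor.id B)) ≅ 𝟙 (E.F.comp E.G) :=
  Pseudofunctor.StrongTrans.isoMk (fun a => E.G.mapId (E.F.obj a))
    (fun f => (postWhiskerId E.F E.G).hom.as.naturality f)

open MonoidalCategory in
/-- The unit constraint of `K`. -/
noncomputable def dimUnitIso : 𝟙_ (Dim A) ≅ E.dimFunctor.obj (𝟙_ (Dim B)) :=
  show 𝟙 (Pseudofunctor.id A) ≅ E.eta ≫ E.conj (𝟙 (Pseudofunctor.id B)) ≫ E.etaStar from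
    E.snakeBirth ≪≫ whiskerLeftIso E.eta
      ((Bicategory.leftUnitor E.etaStar).symm ≪≫ whiskerRightIso E.conjId.symm E.etaStar)

open MonoidalCategory in
/-- `saddleCell` as an isomorphism. -/
def saddleIso (T S : Dim B) :
    E.dimFunctor.obj T ⊗ E.dimFunctor.obj S ≅ E.dimFunctor.obj (T ⊗ S) :=
  show (E.eta ≫ E.conj S ≫ E.etaStar) ≫ (E.eta ≫ E.conj T ≫ E.etaStar) ≅
      E.eta ≫ E.conj (T ⊗ S) ≫ E.etaStar from
  Bicategory.associator E.eta (E.conj S ≫ E.etaStar) (E.eta ≫ E.conj T ≫ E.etaStar) ≪≫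
    whiskerLeftIso E.eta
      (Bicategory.associator (E.conj S) E.etaStar (E.eta ≫ E.conj T ≫ E.etaStar) ≪≫
        whiskerLeftIso (E.conj S)
          ((Bicategory.associator E.etaStar E.eta (E.conj T ≫ E.etaStar)).symm ≪≫
            whiskerRightIso E.s (E.conj T ≫ E.etaStar) ≪≫
            Bicategory.leftUnitor (E.conj T ≫ E.etaStar)) ≪≫
        (Bicategory.associator (E.conj S) (E.conj T) E.etaStar).symm ≪≫
        whiskerRightIso (E.conjComp T S) E.etaStar)

/-- The bridge from modifications to the 2-cells treated by straightening; the two sides differ only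
in how the whiskerings are distributed. -/
theorem homApp_saddleCell (T S : Dim B) (a : A) :
    Dim.homApp (E.saddleCell T S) a = E.merge a (S.app (E.F.obj a)) (T.app (E.F.obj a)) := by
  have h : Dim.homApp (E.saddleCell T S) a = (α_ (unitApp E.eta a) _ _).hom ≫
      unitApp E.eta a ◁ ((α_ (E.G.map (S.app (E.F.obj a))) (counitApp E.etaStar a) _).hom ≫
        E.G.map (S.app (E.F.obj a)) ◁ ((α_ (counitApp E.etaStar a) (unitApp E.eta a)
          (E.G.map (T.app (E.F.obj a)) ≫ counitApp E.etaStar a)).inv ≫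
            (saddleApp E.s a).hom ▷ _ ≫ (λ_ _).hom) ≫ (α_ _ _ _).inv ≫
          (E.G.mapComp (S.app (E.F.obj a)) (T.app (E.F.obj a))).inv ▷ counitApp E.etaStar a) := rfl
  refine h.trans ?_
  rw [merge, conjugateComp]
  simp only [Bicategory.whiskerLeft_comp, Category.assoc]
  rfl

theorem homApp_saddleIso (T S : Dim B) (a : A) :
    Dim.homApp (E.saddleIso T S).hom a = E.merge a (S.app (E.F.obj a)) (T.app (E.F.obj a)) :=
  E.homApp_saddleCell T S a

/-- The monoidal structure of `K`. -/
noncomputable def dimCoreMonoidal : E.dimFunctor.CoreMonoidal where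
  εIso := E.dimUnitIso
  μIso := E.saddleIso
  μIso_hom_natural_left {T T'} θ S := by
    apply Dim.hom_ext; intro a
    have h := E.merge_natural_left a (Dim.homApp θ (E.F.obj a)) (S.app (E.F.obj a))
    rw [← homApp_saddleIso, ← homApp_saddleIso] at h
    exact h
  μIso_hom_natural_right {T T'} S θ := by
    apply Dim.hom_ext; intro a
    have h := E.merge_natural_right a (Dim.homApp θ (E.F.obj a)) (S.app (E.F.obj a))
    rw [← homApp_saddleIso, ← homApp_saddleIso] at h
    exact h
  associativity T S R := by
    apply Dim.hom_ext; intro a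
    -- The order is reversed because T ⊗ S is S ≫ T.
    have h := E.merge_assoc a (R.app (E.F.obj a)) (S.app (E.F.obj a)) (T.app (E.F.obj a))
    rw [← homApp_saddleIso, ← homApp_saddleIso] at h
    have h1 := E.homApp_saddleIso (MonoidalCategory.tensorObj T S) R a
    have h2 := E.homApp_saddleIso T (MonoidalCategory.tensorObj S R) a
    exact (congrArg (fun m => _ ≫ m ≫ _) h1).trans
      (h.trans (congrArg (fun m => _ ≫ _ ≫ m) h2.symm))
  left_unitality T := by
    apply Dim.hom_ext; intro a
    have h := E.merge_unit_left a (T.app (E.F.obj a)) _ (E.leftZigzag_snakeBirthApp a)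
    have h1 := E.homApp_saddleIso (MonoidalCategory.tensorUnit (Dim B)) T a
    exact h.symm.trans (congrArg (fun m => _ ≫ m ≫ _) h1.symm)
  right_unitality T := by
    apply Dim.hom_ext; intro a
    have h := E.merge_unit_right a (T.app (E.F.obj a)) _ (E.leftZigzag_snakeBirthApp a)
    have h1 := E.homApp_saddleIso T (MonoidalCategory.tensorUnit (Dim B)) a
    exact h.symm.trans (congrArg (fun m => _ ≫ m ≫ _) h1.symm)

/-- The braided monoidal structure of `K`. -/
@[reducible]
noncomputable def dimBraided : E.dimFunctor.Braided where
  toMonoidal := E.dimCoreMonoidal.toMonoidal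
  braided T S := by
    apply Dim.hom_ext; intro a
    have h := E.merge_braiding T S a
    rw [← homApp_saddleIso, ← homApp_saddleIso] at h
    exact h

/-! ### The inverse functor -/

/-- `G * L(S) * F ≅ S * G F`, where `L` is the functor of `E.symm`. -/
def conjSymmIso (S : Dim A) :
    E.conj (E.symm.dimFunctor.obj S) ≅ preEndo (E.F.comp E.G) S :=
  Pseudofunctor.StrongTrans.isoMk (fun a => isoApp (E.symm.intertwiner S) (E.F.obj a))
    (fun f => (E.symm.intertwiner S).hom.as.naturality (E.F.map f))

/-- The interchange of `η` and `S`. -/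
def unitInterchange (S : Dim A) :
    E.eta ≫ preEndo (E.F.comp E.G) S ≅ CategoryStruct.comp (obj := Pseudofunctor A A) S E.eta :=
  Pseudofunctor.StrongTrans.isoMk (fun a => S.cell (unitApp E.eta a)) (by
    intro a b f
    change f ◁ (S.cell (unitApp E.eta b)).hom ≫ (α_ _ _ _).inv ≫ (S.cell f).hom ▷ unitApp E.eta b ≫
        (α_ _ _ _).hom ≫ S.app a ◁ (unitCell E.eta f).hom ≫ (α_ _ _ _).inv =
      ((α_ _ _ _).inv ≫ (unitCell E.eta f).hom ▷ S.app (E.G.obj (E.F.obj b)) ≫ (α_ _ _ _).hom ≫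
        unitApp E.eta a ◁ (S.cell (E.G.map (E.F.map f))).hom ≫ (α_ _ _ _).inv) ≫
        (S.cell (unitApp E.eta a)).hom ▷ E.G.map (E.F.map f)
    -- As for ε: naturality of S at the 2-cell η(f), expanded over its composite source and target,
    -- is the modification axiom.
    have h := S.cell_naturality (unitCell E.eta f).hom
    rw [Dim.cell_comp, Dim.cell_comp] at h
    simp only [Category.assoc] at h ⊢
    rw [← cancel_epi (α_ _ _ _).hom, ← cancel_mono (α_ _ _ _).hom]
    simpa using h.symm)

/-- `K(L(S)) ≅ S`. -/
def dimFunctorSymmObjIso (S : Dim A) : E.dimFunctor.obj (E.symm.dimFunctor.obj S) ≅ S :=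
  show E.eta ≫ E.conj (E.symm.dimFunctor.obj S) ≫ E.etaStar ≅
      (show Pseudofunctor.id A ⟶ Pseudofunctor.id A from S) from
    -- Straighten G * L(S) * F, interchange S with η, then cancel η* ∘ η. The original `b` suffices
    -- because no snake equation is needed here.
    whiskerLeftIso E.eta (whiskerRightIso (E.conjSymmIso S) E.etaStar) ≪≫
      (Bicategory.associator _ _ _).symm ≪≫ whiskerRightIso (E.unitInterchange S) E.etaStar ≪≫
      Bicategory.associator _ _ _ ≪≫ whiskerLeftIso _ E.b.symm ≪≫ Bicategory.rightUnitor _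

/-- `K ∘ L ≅ id`. -/
def dimFunctorSymmIso : E.symm.dimFunctor ⋙ E.dimFunctor ≅ 𝟭 (Dim A) :=
  NatIso.ofComponents E.dimFunctorSymmObjIso (by
    intro S S' θ
    apply Dim.hom_ext; intro a
    have h := congrArg (fun m => unitApp E.eta a ◁ m ▷ counitApp E.etaStar a)
      (E.symm.straighten_natural (E.F.obj a) (Dim.homApp θ (E.G.obj (E.F.obj a))))
    exact interchange_whisker_natural h (Dim.homApp_cell θ (unitApp E.eta a)) (isoApp E.b a).inv)

/-- `E.symm.symm` is `E` by definition, so the same isomorphism for `E.symm` handles the other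
composite. -/
theorem dimFunctor_isEquivalence : E.dimFunctor.IsEquivalence :=
  (CategoryTheory.Equivalence.mk E.dimFunctor E.symm.dimFunctor E.symm.dimFunctorSymmIso.symm
    E.dimFunctorSymmIso).isEquivalence_functor

end CoherentAdjointEquivalence
end HigherDimension

theorem mainTheorem8 {A : Type u₁} [Bicategory.{w₁, v₁} A] {B : Type u₂} [Bicategory.{w₂, v₂} B]
    (E : HigherDimension.CoherentAdjointEquivalence A B) :
    E.dimFunctor.IsEquivalence ∧
      ∃ K : E.dimFunctor.Braided, ∀ T S : HigherDimension.Dim B,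
        K.toMonoidal.toLaxMonoidal.μ T S = E.saddleCell T S :=
  -- The constraint is the forward map of `saddleIso`, which unfolds to `saddleCell`.
  ⟨E.dimFunctor_isEquivalence, E.dimBraided, fun _ _ => rfl⟩
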